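/- Let $B$ be a one-dimensional Brownian motion on a complete probability space $(\Omega,\mathcal F,\mathbb P)$ and let $\mathcal F_\tau$ be the $\sigma$-algebra generated by $(B_s)_{0\le s\le\tau}$ and the $\mathbb P$-null sets. Let $r,\mu\in\mathbb R$, $\sigma>0$, $\tau>0$, $\alpha\in(0,1)$, $k\ge 0$, $\gamma>0$, $\delta>0$, $\beta\in[0,1]$, put $\phi:=(\mu-r)/\sigma$ and assume $\phi\neq 0$ and $$\delta>h:=r\alpha+\frac{\alpha\phi^2}{2(1-\alpha)} .$$ Define $Z_\tau:=\exp\bigl(-\phi B_\tau-(r+\tfrac{\phi^2}{2})\tau\bigr)$, $\mathcal Y:=\{Y : Y \text{ is } \mathcal F_\tau\text{-measurable},\ Y\ge 0,\ \mathbb E[Z_\tau Y]\le 1\}$, $U(x):=x^\alpha$ for $x\ge 0$ and $U(x):=-k|x|^\alpha$ for $x<0$, $F(y;\theta):=U(y-\gamma)+\theta y^\alpha$ for $y\ge0$, $\theta\in\mathbb R$, and $\Phi(\theta):=\sup_{Y\in\mathcal Y}\mathbb E[F(Y;\theta)]$. For every $\kappa\in[0,1]$ the map $\theta\mapsto e^{-\delta\tau}\Phi(\kappa\theta)$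 has exactly one fixed point in $\mathbb R$, denoted $\theta^*(\kappa)$. For $\xi\in[0,e^{h\tau}]$ put $\kappa(\xi):=\frac{\beta}{1-(1-\beta)e^{-\delta\tau}\xi}$, which lies in $[0,1]$, and $$G(\xi):=\Bigl\{\mathbb E[Y^\alpha] \;:\; Y\in\operatorname*{arg\,max}_{Y\in\mathcal Y}\mathbb E\bigl[F\bigl(Y;\kappa(\xi)\,\theta^*(\kappa(\xi))\bigr)\bigr]\Bigr\}\subseteq[0,e^{h\tau}].$$ **Theorem.** The set-valued map $G$ has a fixed point in $[0,e^{h\tau}]$, i.e. there is $\hat\xi\in[0,e^{h\tau}]$ with $\hat\xi\in G(\hat\xi)$. Specifically: 1. If $\theta^*(0)>0$, then $G$ has at least one fixed point. 2. If $\theta^*(0)=0$, then the set $\{\mathbb E[Y^\alpha] : Y\in\operatorname{arg\,max}_{Y\in\mathcal Y}\mathbb E[U(Y-\gamma)]\}$ consists of a single number, and this number is the one and only fixed point of $G$. 3. If $\theta^*(0)<0$, and either $\beta<1$ or $\theta^*(1)\neq-(1+k^{1/(1-\alpha)})^{1-\alpha}$, then $G$ has exactly one fixed point. -/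

import Mathlib

open MeasureTheory ProbabilityTheory Set
open scoped NNReal

noncomputable section

namespace PresentBias

/-- The real parameters of the model: the Black-Scholes market (`r`, `μ`, `σ`), the length `τ` of an
evaluation period, and the preference parameters (`α`, `k`, `γ`, `δ`, `β`). -/
structure Params where
  /-- risk free rate -/
  r : ℝ
  /-- drift of the risky asset -/
  μ : ℝ
  /-- volatility of the risky asset -/
  σ : ℝ
  /-- length of an evaluation period -/
  τ : ℝ≥0
  /-- risk aversion / risk seeking exponent -/
  α : ℝ
  /-- loss aversion -/
  k : ℝ
  /-- performance benchmark -/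
  γ : ℝ
  /-- discount rate -/
  δ : ℝ
  /-- myopia level -/
  β : ℝ

namespace Params

variable (p : Params)

/-- Market price of risk `φ = (μ - r) / σ`. -/
def φ : ℝ := (p.μ - p.r) / p.σ

/-- `h = r α + α φ² / (2 (1 - α))`. -/
def h : ℝ := p.r * p.α + p.α * p.φ ^ 2 / (2 * (1 - p.α))

/-- The one-period discount factor `e^{-δτ}`. -/
def disc : ℝ := Real.exp (-p.δ * p.τ)

/-- Piecewise power (S-shaped) utility. -/
def U (x : ℝ) : ℝ := if 0 ≤ x then x ^ p.α else -p.k * |x| ^ p.α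

/-- `F(y; θ) = U(y - γ) + θ y^α`. -/
def F (y θ : ℝ) : ℝ := p.U (y - p.γ) + θ * y ^ p.α

/-- `θ̲ = -(1 + k^{1/(1-α)})^{1-α}`. -/
def thetaLow : ℝ := -(1 + p.k ^ (1 / (1 - p.α))) ^ (1 - p.α)

/-- `κ(ξ) = β / (1 - (1 - β) e^{-δτ} ξ)`. -/
def kappa (ξ : ℝ) : ℝ := p.β / (1 - (1 - p.β) * p.disc * ξ)

end Params

/-- The time-`t` σ-algebra of the filtration generated by `B`, augmented by the `P`-null sets. -/
@[reducible]
def augmented {Ω : Type*} {mΩ : MeasurableSpace Ω} (B : ℝ≥0 → Ω → ℝ) (P : Measure Ω) (t : ℝ≥0) :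
    MeasurableSpace Ω :=
  (⨆ s ∈ Iic t, MeasurableSpace.comap (B s) inferInstance) ⊔
    MeasurableSpace.generateFrom {N : Set Ω | P N = 0}

section

variable {Ω : Type*} [MeasurableSpace Ω] (P : Measure Ω) (B : ℝ≥0 → Ω → ℝ) (p : Params)

/-- The pricing kernel `Z_t = exp(-φ B_t - (r + φ²/2) t)`. -/
def kernelZ (t : ℝ≥0) (ω : Ω) : ℝ :=
  Real.exp (-p.φ * B t ω - (p.r + p.φ ^ 2 / 2) * t)

/-- The set `𝒴` of one-period gross returns: nonnegative `ℱ_τ`-measurable random variables `Y` with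
`E[Z_τ Y] ≤ 1` (in particular this expectation is finite). -/
def returns : Set (Ω → ℝ) :=
  {Y | Measurable[augmented B P p.τ] Y ∧ (∀ ω, 0 ≤ Y ω) ∧
    Integrable (fun ω => kernelZ B p p.τ ω * Y ω) P ∧
    ∫ ω, kernelZ B p p.τ ω * Y ω ∂P ≤ 1}

/-- `argmax_{Y ∈ 𝒴} E[f(Y)]`. -/
def optimizers (f : ℝ → ℝ) : Set (Ω → ℝ) :=
  {Y | Y ∈ returns P B p ∧ ∀ Y' ∈ returns P B p, ∫ ω, f (Y' ω) ∂P ≤ ∫ ω, f (Y ω) ∂P}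

/-- The set of the values `E[Y^α]`, where `Y` ranges over `argmax_{Y ∈ 𝒴} E[f(Y)]`. -/
def optimalMoments (f : ℝ → ℝ) : Set ℝ :=
  (fun Y : Ω → ℝ => ∫ ω, Y ω ^ p.α ∂P) '' optimizers P B p f

/-- `Φ(θ) = sup_{Y ∈ 𝒴} E[F(Y; θ)]`. -/
def Phi (θ : ℝ) : ℝ :=
  sSup ((fun Y : Ω → ℝ => ∫ ω, p.F (Y ω) θ ∂P) '' returns P B p)

/-- `θ*(κ)`: the fixed point of `θ ↦ e^{-δτ} Φ(κ θ)`. (That there is exactly one for every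
`κ ∈ [0,1]` is part of the theorem.) -/
def thetaStar (κ : ℝ) : ℝ :=
  Classical.epsilon fun θ : ℝ => θ = p.disc * Phi P B p (κ * θ)

/-- The set-valued map `G`. -/
def G (ξ : ℝ) : Set ℝ :=
  optimalMoments P B p fun y => p.F y (p.kappa ξ * thetaStar P B p (p.kappa ξ))

end

end PresentBias

end

noncomputable section

open Filter Topology

set_option linter.unusedSectionVars false

/-! For each return `Y` the map `θ ↦ E[F(Y; θ)]` is affine with slope `E[Y^α]`, and Hölder's
inequality puts this slope in `[0, e^{hτ}]`. So `Φ` is convex, nondecreasing and `e^{hτ}`-Lipschitz,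
and an optimizer at `θ` contributes a subgradient of `Φ` at `θ`. The core of the proof is the
converse (`optimalMoments_eq_subgradients`): every subgradient is the moment of an optimizer. Hence
`G(ξ)` is the subdifferential of `Φ` at `κ(ξ) θ*(κ(ξ))`.

The converse rests on Lagrangian duality. As `Z` has no atoms, the maximizer of `F(y; θ) - l Z y` is
almost surely unique. If some `l > 0` makes it cost exactly 1, it is optimal and its moment is the
only subgradient. Otherwise the budget is slack, and optimal returns take values among the
maximizers of `F(·; θ)`. A single maximizer again gives a single subgradient. Two maximizers, `0`
and some `y > γ`, coexist only if `θ = thetaLow`; then the returns `y 1_{Z ≤ c}` realize the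
subgradients below `y^α`, and the constant `y` realizes `y^α` when it is a subgradient.

Since `δ > h`, the map `θ ↦ e^{-δτ} Φ(κθ)` is a contraction, so `θ*` is well defined and continuous
in `κ`. Convexity and closedness of subdifferentials, with connectedness of `[0, e^{hτ}]`, give a
fixed point of `G`. If `θ*(0) < 0`, then `κ θ*(κ)` strictly decreases in `κ`; monotonicity of
subgradients makes `G` nonincreasing when `0 < β < 1`, while for `β ∈ {0, 1}` it is constant and
single-valued. If `θ*(0) = 0`, then `θ*` vanishes identically and `G` is constant. -/

namespace PresentBias

/-! ### The pointwise Lagrangian problem. -/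

namespace Params

variable {p : Params}

/-- The maximizers over `[0, ∞)` of the Lagrangian `y ↦ F(y; θ) - x y`. -/
def argmaxSet (p : Params) (θ x : ℝ) : Set ℝ :=
  {y | 0 ≤ y ∧ ∀ y', 0 ≤ y' → p.F y' θ - x * y' ≤ p.F y θ - x * y}

lemma continuous_rpow_alpha (hα : p.α ∈ Ioo (0 : ℝ) 1) : Continuous fun y : ℝ => y ^ p.α :=
  Real.continuous_rpow_const hα.1.le

lemma continuous_U (hα : p.α ∈ Ioo (0 : ℝ) 1) : Continuous p.U := by
  unfold U
  refine Continuous.if_le (continuous_rpow_alpha hα)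
    (continuous_const.mul ((continuous_rpow_alpha hα).comp continuous_abs))
    continuous_const continuous_id ?_
  intro x hx
  rw [← hx]
  simp [Real.zero_rpow hα.1.ne']

lemma continuous_F (hα : p.α ∈ Ioo (0 : ℝ) 1) : Continuous fun q : ℝ × ℝ => p.F q.1 q.2 := by
  unfold F
  exact ((continuous_U hα).comp (continuous_fst.sub continuous_const)).add
    (continuous_snd.mul ((continuous_rpow_alpha hα).comp continuous_fst))

lemma U_of_nonneg {x : ℝ} (hx : 0 ≤ x) : p.U x = x ^ p.α := by simp [U, hx]

lemma U_of_nonpos (hα : p.α ∈ Ioo (0 : ℝ) 1) {x : ℝ} (hx : x ≤ 0) :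
    p.U x = -p.k * (-x) ^ p.α := by
  rcases hx.lt_or_eq with h | h
  · simp [U, not_le.2 h, abs_of_neg h]
  · simp [h, U, Real.zero_rpow hα.1.ne']

lemma F_add (p : Params) (y θ c : ℝ) : p.F y (θ + c) = p.F y θ + c * y ^ p.α := by
  unfold F; ring

lemma F_zero (hα : p.α ∈ Ioo (0 : ℝ) 1) (hγ : 0 < p.γ) (θ : ℝ) :
    p.F 0 θ = -p.k * p.γ ^ p.α := by
  unfold F
  rw [U_of_nonpos hα (by linarith), Real.zero_rpow hα.1.ne']
  simp

lemma abs_U_sub_le (hα : p.α ∈ Ioo (0 : ℝ) 1) (hk : 0 ≤ p.k) (hγ : 0 < p.γ) {y : ℝ} (hy : 0 ≤ y) :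
    |p.U (y - p.γ)| ≤ p.k * p.γ ^ p.α + y ^ p.α := by
  have h1 : 0 ≤ p.γ ^ p.α := Real.rpow_nonneg hγ.le _
  have h2 : 0 ≤ y ^ p.α := Real.rpow_nonneg hy _
  rcases le_total p.γ y with h | h
  · rw [U_of_nonneg (by linarith), abs_of_nonneg (Real.rpow_nonneg (by linarith) _)]
    have := Real.rpow_le_rpow (by linarith : 0 ≤ y - p.γ) (by linarith : y - p.γ ≤ y) hα.1.le
    have := mul_nonneg hk h1
    linarith
  · rw [U_of_nonpos hα (by linarith), neg_sub, neg_mul, abs_neg,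
      abs_of_nonneg (mul_nonneg hk (Real.rpow_nonneg (by linarith) _))]
    have := Real.rpow_le_rpow (by linarith : 0 ≤ p.γ - y) (by linarith : p.γ - y ≤ p.γ) hα.1.le
    have := mul_le_mul_of_nonneg_left this hk
    linarith

/-- Subadditivity of `x ↦ x^α` below the benchmark. Measuring the gain from `y = 0` is what bounds
Lagrangian maximizers: they satisfy `x y ≤ C y^α`. -/
lemma U_sub_le (hα : p.α ∈ Ioo (0 : ℝ) 1) (hk : 0 ≤ p.k) (hγ : 0 < p.γ) {y : ℝ} (hy : 0 ≤ y) :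
    p.U (y - p.γ) ≤ -p.k * p.γ ^ p.α + (1 + p.k) * y ^ p.α := by
  have h2 : 0 ≤ y ^ p.α := Real.rpow_nonneg hy _
  rcases le_total p.γ y with h | h
  · rw [U_of_nonneg (by linarith)]
    have h3 := Real.rpow_le_rpow (by linarith : 0 ≤ y - p.γ) (by linarith : y - p.γ ≤ y) hα.1.le
    have h4 := Real.rpow_le_rpow hγ.le h hα.1.le
    nlinarith [mul_le_mul_of_nonneg_left h4 hk]
  · rw [U_of_nonpos hα (by linarith), neg_sub]
    have h3 := Real.rpow_add_le_add_rpow (by linarith : 0 ≤ p.γ - y) hy hα.1.le hα.2.le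
    rw [sub_add_cancel] at h3
    nlinarith [mul_le_mul_of_nonneg_left h3 hk]

lemma F_le (hα : p.α ∈ Ioo (0 : ℝ) 1) (hk : 0 ≤ p.k) (hγ : 0 < p.γ) (θ : ℝ) {y : ℝ} (hy : 0 ≤ y) :
    p.F y θ ≤ p.F 0 θ + (1 + p.k + |θ|) * y ^ p.α := by
  rw [F_zero hα hγ]
  have := U_sub_le hα hk hγ hy
  have h2 : 0 ≤ y ^ p.α := Real.rpow_nonneg hy _
  have := mul_le_mul_of_nonneg_right (le_abs_self θ) h2
  unfold F
  linarith

lemma rpow_bound {a x y C : ℝ} (ha : a ∈ Ioo (0 : ℝ) 1) (hx : 0 < x) (hC : 0 ≤ C) (hy : 0 ≤ y)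
    (h : x * y ≤ C * y ^ a) : y ≤ (C / x) ^ (1 / (1 - a)) := by
  rcases hy.eq_or_lt with rfl | hy0
  · exact Real.rpow_nonneg (div_nonneg hC hx.le) _
  have h1 : 0 < 1 - a := by linarith [ha.2]
  have hya : 0 < y ^ a := Real.rpow_pos_of_pos hy0 _
  have h2 : y ^ (1 - a) ≤ C / x := by
    rw [Real.rpow_sub hy0, Real.rpow_one, div_le_div_iff₀ hya hx]
    linarith
  calc y = (y ^ (1 - a)) ^ (1 / (1 - a)) := by
        rw [← Real.rpow_mul hy, mul_one_div_cancel h1.ne', Real.rpow_one]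
    _ ≤ _ := Real.rpow_le_rpow (Real.rpow_nonneg hy _) h2 (by positivity)

lemma mul_le_of_lagrangian_ge (hα : p.α ∈ Ioo (0 : ℝ) 1) (hk : 0 ≤ p.k) (hγ : 0 < p.γ)
    {θ x y : ℝ} (hx : 0 < x) (hy : 0 ≤ y) (h : p.F 0 θ ≤ p.F y θ - x * y) :
    y ≤ ((1 + p.k + |θ|) / x) ^ (1 / (1 - p.α)) := by
  refine rpow_bound hα hx (by positivity) hy ?_
  linarith [F_le hα hk hγ θ hy]

lemma argmaxSet_le (hα : p.α ∈ Ioo (0 : ℝ) 1) (hk : 0 ≤ p.k) (hγ : 0 < p.γ) {θ x y : ℝ}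
    (hx : 0 < x) (hy : y ∈ p.argmaxSet θ x) :
    y ≤ ((1 + p.k + |θ|) / x) ^ (1 / (1 - p.α)) :=
  mul_le_of_lagrangian_ge hα hk hγ hx hy.1 (by simpa using hy.2 0 le_rfl)

lemma argmaxSet_nonempty (hα : p.α ∈ Ioo (0 : ℝ) 1) (hk : 0 ≤ p.k) (hγ : 0 < p.γ) {θ x : ℝ}
    (hx : 0 < x) : (p.argmaxSet θ x).Nonempty := by
  set b := ((1 + p.k + |θ|) / x) ^ (1 / (1 - p.α)) with hb
  have hb0 : 0 ≤ b := Real.rpow_nonneg (by positivity) _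
  have hc : Continuous fun y => p.F y θ - x * y :=
    ((continuous_F hα).comp (continuous_id.prodMk continuous_const)).sub
      (continuous_const.mul continuous_id)
  obtain ⟨y, hy, hmax⟩ := isCompact_Icc.exists_isMaxOn ⟨0, left_mem_Icc.2 hb0⟩ hc.continuousOn
  refine ⟨y, hy.1, fun y' hy' => ?_⟩
  have h0 : p.F 0 θ - x * 0 ≤ p.F y θ - x * y := hmax (left_mem_Icc.2 hb0)
  rcases le_total (p.F 0 θ) (p.F y' θ - x * y') with h | h
  · exact hmax ⟨hy', mul_le_of_lagrangian_ge hα hk hγ hx hy' h⟩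
  · linarith

/-- Adding the two optimality inequalities leaves `(x' - x)(y - y') ≥ 0`. -/
lemma argmaxSet_antitone {θ x x' y y' : ℝ} (hx : x < x') (hy : y ∈ p.argmaxSet θ x)
    (hy' : y' ∈ p.argmaxSet θ x') : y' ≤ y := by
  have h1 := hy.2 y' hy'.1
  have h2 := hy'.2 y hy.1
  nlinarith

/-- The argmax correspondence has closed graph. -/
lemma mem_argmaxSet_of_tendsto (hα : p.α ∈ Ioo (0 : ℝ) 1) {ι : Type*} {l : Filter ι} [l.NeBot]
    {θ x y : ι → ℝ} {θ₀ x₀ y₀ : ℝ} (hθ : Tendsto θ l (𝓝 θ₀)) (hx : Tendsto x l (𝓝 x₀))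
    (hy : Tendsto y l (𝓝 y₀)) (h : ∀ᶠ i in l, y i ∈ p.argmaxSet (θ i) (x i)) :
    y₀ ∈ p.argmaxSet θ₀ x₀ := by
  refine ⟨ge_of_tendsto hy (h.mono fun i hi => hi.1), fun y' hy' => ?_⟩
  have hF := fun {u : ι → ℝ} {u₀ : ℝ} (hu : Tendsto u l (𝓝 u₀)) =>
    (((continuous_F hα).tendsto (u₀, θ₀)).comp (hu.prodMk_nhds hθ)).sub (hx.mul hu)
  exact le_of_tendsto_of_tendsto (hF (tendsto_const_nhds (x := y'))) (hF hy)
    (h.mono fun i hi => hi.2 y' hy')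

/-- If the limit problem has a unique solution, then bounded solutions converge to it. -/
lemma tendsto_of_argmaxSet_subset (hα : p.α ∈ Ioo (0 : ℝ) 1) {ι : Type*} {l : Filter ι}
    {θ x y : ι → ℝ} {θ₀ x₀ y₀ b : ℝ} (hθ : Tendsto θ l (𝓝 θ₀)) (hx : Tendsto x l (𝓝 x₀))
    (h : ∀ᶠ i in l, y i ∈ p.argmaxSet (θ i) (x i)) (hb : ∀ᶠ i in l, y i ≤ b)
    (hu : p.argmaxSet θ₀ x₀ ⊆ {y₀}) : Tendsto y l (𝓝 y₀) := by
  refine (isCompact_Icc (a := 0) (b := b)).tendsto_nhds_of_unique_mapClusterPt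
    (by filter_upwards [h, hb] with i hi hib using ⟨hi.1, hib⟩) ?_
  intro w _ hw
  obtain ⟨V, hV, hVw⟩ := mapClusterPt_iff_ultrafilter.1 hw
  exact hu (mem_argmaxSet_of_tendsto hα (hθ.mono_left hV) (hx.mono_left hV) hVw (hV h))

/-! ### Maximizers of `F(·; θ)` -/

lemma F_lt_F_benchmark_add_one (hα : p.α ∈ Ioo (0 : ℝ) 1) (hk : 0 ≤ p.k)
    {θ y : ℝ} (hθ : 0 ≤ θ) (hy : 0 ≤ y) (hyγ : y ≤ p.γ) :
    p.F y θ < p.F (p.γ + 1) θ := by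
  unfold F
  rw [U_of_nonpos hα (by linarith), U_of_nonneg (by linarith)]
  have h1 := Real.rpow_le_rpow hy (by linarith : y ≤ p.γ + 1) hα.1.le
  have h2 := mul_le_mul_of_nonneg_left h1 hθ
  have h3 : 0 ≤ p.k * (-(y - p.γ)) ^ p.α := mul_nonneg hk (Real.rpow_nonneg (by linarith) _)
  have h4 : (p.γ + 1 - p.γ) ^ p.α = 1 := by simp
  linarith

/-- The gain `t^α` of moving from `γ` to `γ + t` has infinite slope at `t = 0`, while by Bernoulli's
inequality the loss through `θ y^α` is at most linear in `t`. -/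
lemma exists_F_gt_benchmark (hα : p.α ∈ Ioo (0 : ℝ) 1) (hγ : 0 < p.γ) {θ : ℝ} (hθ : θ < 0) :
    ∃ y, 0 ≤ y ∧ p.F p.γ θ < p.F y θ := by
  by_contra! hcon
  have hg : 0 < p.γ ^ p.α := Real.rpow_pos_of_pos hγ _
  set C := -θ * (p.γ ^ p.α * (p.α / p.γ)) with hC
  have key : ∀ t : ℝ, 0 < t → t ^ p.α ≤ C * t := by
    intro t ht
    have h := hcon (p.γ + t) (by linarith)
    unfold F at h
    rw [U_of_nonneg (by linarith), U_of_nonneg (by linarith), sub_self,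
      Real.zero_rpow hα.1.ne', add_sub_cancel_left] at h
    have hb : (p.γ + t) ^ p.α ≤ p.γ ^ p.α * (1 + p.α * (t / p.γ)) := by
      have : p.γ + t = p.γ * (1 + t / p.γ) := by field_simp
      rw [this, Real.mul_rpow hγ.le (by positivity)]
      refine mul_le_mul_of_nonneg_left ?_ hg.le
      exact rpow_one_add_le_one_add_mul_self (by linarith [div_pos ht hγ]) hα.1.le hα.2.le
    have h5 := mul_le_mul_of_nonneg_left hb (by linarith : 0 ≤ -θ)
    have : C * t = -θ * (p.γ ^ p.α * (1 + p.α * (t / p.γ))) - -θ * p.γ ^ p.α := by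
      rw [hC]; field_simp; ring
    rw [this]
    linarith
  have hC0 : 0 < C := by
    have := key 1 one_pos
    simp at this
    linarith
  have h1 : 0 < 1 - p.α := by linarith [hα.2]
  -- Chosen so that `t^α = 2 C t`, which violates `key`.
  set t := (1 / (2 * C)) ^ (1 / (1 - p.α)) with ht
  have htp : 0 < t := Real.rpow_pos_of_pos (by positivity) _
  have h2 : t ^ (1 - p.α) = 1 / (2 * C) := by
    rw [ht, ← Real.rpow_mul (by positivity), one_div_mul_cancel h1.ne', Real.rpow_one]
  have h3 : t = t ^ p.α * t ^ (1 - p.α) := by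
    rw [← Real.rpow_add htp]; simp
  have h4 := key t htp
  have h5 : 0 < t ^ p.α := Real.rpow_pos_of_pos htp _
  rw [h2, mul_one_div, eq_div_iff (by positivity)] at h3
  linarith

/-- For `θ ≤ 0` the function `F(·; θ)` is convex on `[0, γ]`. -/
lemma F_le_chord (hα : p.α ∈ Ioo (0 : ℝ) 1) (hk : 0 ≤ p.k) (hγ : 0 < p.γ) {θ y : ℝ}
    (hθ : θ ≤ 0) (hy : 0 ≤ y) (hyγ : y ≤ p.γ) :
    p.F y θ ≤ (1 - y / p.γ) * p.F 0 θ + y / p.γ * p.F p.γ θ := by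
  rw [F_zero hα hγ]
  unfold F
  rw [U_of_nonpos hα (by linarith), sub_self, U_of_nonneg le_rfl, Real.zero_rpow hα.1.ne', neg_sub]
  have hg : 0 < p.γ ^ p.α := Real.rpow_pos_of_pos hγ _
  -- Both powers carry nonpositive coefficients, `-k` and `θ`, so convexity reduces to `w ≤ w^α` on
  -- `[0, 1]`.
  have hself : ∀ w : ℝ, 0 ≤ w → w ≤ 1 → w ≤ w ^ p.α := fun w h0 h1 => by
    rcases h0.eq_or_lt with rfl | h0
    · exact Real.rpow_nonneg le_rfl _
    · simpa using Real.rpow_le_rpow_of_exponent_ge h0 h1 hα.2.le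
  set w := y / p.γ with hw
  have hw0 : 0 ≤ w := by positivity
  have hw1 : w ≤ 1 := (div_le_one hγ).2 hyγ
  have hyw : y = p.γ * w := by rw [hw]; field_simp
  have e1 : y ^ p.α = p.γ ^ p.α * w ^ p.α := by rw [hyw, Real.mul_rpow hγ.le hw0]
  have e2 : (p.γ - y) ^ p.α = p.γ ^ p.α * (1 - w) ^ p.α := by
    rw [← Real.mul_rpow hγ.le (by linarith), hyw]; ring_nf
  rw [e1, e2]
  have h1 := mul_le_mul_of_nonneg_left (hself w hw0 hw1) hg.le
  have h2 := mul_le_mul_of_nonneg_left (hself (1 - w) (by linarith) (by linarith)) hg.le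
  have h3 := mul_le_mul_of_nonneg_left h1 (by linarith : 0 ≤ -θ)
  have h4 := mul_le_mul_of_nonneg_left h2 hk
  nlinarith

/-- For `θ ≥ 0` the point `γ + 1` beats all of `[0, γ]`. For `θ < 0` the chord bound places `F(y)`
below an average of `F(0) ≤ F(y)` and `F(γ) < F(y)` with positive weight on the latter. -/
lemma benchmark_lt_of_mem_argmaxSet (hα : p.α ∈ Ioo (0 : ℝ) 1) (hk : 0 ≤ p.k) (hγ : 0 < p.γ)
    {θ y : ℝ} (hy : y ∈ p.argmaxSet θ 0) (hpos : 0 < y) : p.γ < y := by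
  by_contra! hle
  have hmax : ∀ y', 0 ≤ y' → p.F y' θ ≤ p.F y θ := fun y' h => by simpa using hy.2 y' h
  rcases le_or_gt 0 θ with hθ | hθ
  · have := F_lt_F_benchmark_add_one hα hk hθ hpos.le hle
    linarith [hmax (p.γ + 1) (by linarith)]
  · obtain ⟨y', hy', hgt⟩ := exists_F_gt_benchmark hα hγ hθ
    have h1 := F_le_chord hα hk hγ hθ.le hpos.le hle
    have h2 := hmax y' hy'
    have h3 := hmax 0 le_rfl
    have hw0 : 0 < y / p.γ := by positivity
    have hw1 : y / p.γ ≤ 1 := (div_le_one hγ).2 hle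
    nlinarith

/-- Stated through `(y - γ)/y`, a strictly increasing function of `y`, so that it determines `y`. -/
lemma first_order_condition (hα : p.α ∈ Ioo (0 : ℝ) 1) (hk : 0 ≤ p.k) (hγ : 0 < p.γ)
    {θ y : ℝ} (hy : y ∈ p.argmaxSet θ 0) (hpos : 0 < y) :
    ((y - p.γ) / y) ^ (p.α - 1) = -θ := by
  have hγy := benchmark_lt_of_mem_argmaxSet hα hk hγ hy hpos
  have hd : HasDerivAt (fun w : ℝ => (w - p.γ) ^ p.α + θ * w ^ p.α)
      (1 * p.α * (y - p.γ) ^ (p.α - 1) + θ * (1 * p.α * y ^ (p.α - 1))) y :=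
    (((hasDerivAt_id y).sub_const p.γ).rpow_const (Or.inl (by simp; linarith))).add
      (((hasDerivAt_id y).rpow_const (Or.inl hpos.ne')).const_mul θ)
  have hloc : IsLocalMax (fun w : ℝ => (w - p.γ) ^ p.α + θ * w ^ p.α) y := by
    filter_upwards [Ioi_mem_nhds hγy] with w hw
    have hw' : p.γ < w := hw
    have := hy.2 w (by linarith)
    unfold F at this
    rw [U_of_nonneg (by linarith), U_of_nonneg (by linarith)] at this
    simpa using this
  have h0 := hloc.hasDerivAt_eq_zero hd
  have hyp : 0 < y ^ (p.α - 1) := Real.rpow_pos_of_pos hpos _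
  rw [Real.div_rpow (by linarith) hpos.le, div_eq_iff hyp.ne']
  have : p.α * ((y - p.γ) ^ (p.α - 1) + θ * y ^ (p.α - 1)) = 0 := by linarith
  rcases mul_eq_zero.1 this with h | h
  · exact absurd h hα.1.ne'
  · linarith

lemma eq_of_mem_argmaxSet_of_pos (hα : p.α ∈ Ioo (0 : ℝ) 1) (hk : 0 ≤ p.k) (hγ : 0 < p.γ)
    {θ y y' : ℝ} (hy : y ∈ p.argmaxSet θ 0) (hpos : 0 < y) (hy' : y' ∈ p.argmaxSet θ 0)
    (hpos' : 0 < y') : y = y' := by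
  have h1 := benchmark_lt_of_mem_argmaxSet hα hk hγ hy hpos
  have h2 := benchmark_lt_of_mem_argmaxSet hα hk hγ hy' hpos'
  have h3 := (first_order_condition hα hk hγ hy hpos).trans
    (first_order_condition hα hk hγ hy' hpos').symm
  have ha : p.α - 1 ≠ 0 := by linarith [hα.2]
  have hq : 0 < (y - p.γ) / y := div_pos (by linarith) hpos
  have hq' : 0 < (y' - p.γ) / y' := div_pos (by linarith) hpos'
  have h4 := congrArg (fun w : ℝ => w ^ (p.α - 1)⁻¹) h3
  simp only [Real.rpow_rpow_inv hq.le ha, Real.rpow_rpow_inv hq'.le ha] at h4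
  rw [div_eq_div_iff hpos.ne' hpos'.ne'] at h4
  nlinarith

/-- With `k = c^(1-α)`, Hölder's inequality gives `(y - γ)^α + k γ^α ≤ y^α (1 + c)^(1-α)` for `y ≥
γ`; it is obtained by adding two weighted AM-GM inequalities. Below `γ`, subadditivity and `k ≤ (1 +
c)^(1-α)` suffice. -/
lemma zero_mem_argmaxSet_thetaLow (hα : p.α ∈ Ioo (0 : ℝ) 1) (hk : 0 ≤ p.k) (hγ : 0 < p.γ) :
    (0 : ℝ) ∈ p.argmaxSet p.thetaLow 0 := by
  refine ⟨le_rfl, fun y hy => ?_⟩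
  simp only [zero_mul, sub_zero]
  rw [F_zero hα hγ]
  have h1 : 0 < 1 - p.α := by linarith [hα.2]
  set c := p.k ^ (1 / (1 - p.α)) with hc
  have hc0 : 0 ≤ c := Real.rpow_nonneg hk _
  have hck : c ^ (1 - p.α) = p.k := by
    rw [hc, ← Real.rpow_mul hk, one_div_mul_cancel h1.ne', Real.rpow_one]
  have hlow : p.thetaLow = -(1 + c) ^ (1 - p.α) := rfl
  have hKpos : 0 < (1 + c) ^ (1 - p.α) := Real.rpow_pos_of_pos (by linarith) _
  unfold F
  rw [hlow]
  rcases le_total p.γ y with h | h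
  · rw [U_of_nonneg (by linarith)]
    have hy0 : 0 < y := by linarith
    have e1 : ((y - p.γ) / y) ^ p.α * (1 / (1 + c)) ^ (1 - p.α) ≤
        p.α * ((y - p.γ) / y) + (1 - p.α) * (1 / (1 + c)) :=
      Real.geom_mean_le_arith_mean2_weighted hα.1.le h1.le (div_nonneg (by linarith) hy)
        (by positivity) (by ring)
    have e2 : (p.γ / y) ^ p.α * (c / (1 + c)) ^ (1 - p.α) ≤
        p.α * (p.γ / y) + (1 - p.α) * (c / (1 + c)) :=
      Real.geom_mean_le_arith_mean2_weighted hα.1.le h1.le (by positivity)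
        (by positivity) (by ring)
    have e3 : p.α * ((y - p.γ) / y) + (1 - p.α) * (1 / (1 + c)) +
        (p.α * (p.γ / y) + (1 - p.α) * (c / (1 + c))) = 1 := by
      field_simp; ring
    rw [Real.div_rpow (by linarith) hy, Real.div_rpow (by linarith) (by linarith),
      Real.one_rpow] at e1
    rw [Real.div_rpow hγ.le hy, Real.div_rpow hc0 (by linarith), hck] at e2
    have hya : 0 < y ^ p.α := Real.rpow_pos_of_pos hy0 _
    have e4 : ((y - p.γ) ^ p.α + p.k * p.γ ^ p.α) / (y ^ p.α * (1 + c) ^ (1 - p.α)) ≤ 1 := by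
      refine le_trans (le_of_eq ?_) ((add_le_add e1 e2).trans e3.le)
      field_simp
    rw [div_le_one (by positivity)] at e4
    linarith
  · rw [U_of_nonpos hα (by linarith), neg_sub]
    have h3 := Real.rpow_add_le_add_rpow (by linarith : 0 ≤ p.γ - y) hy hα.1.le hα.2.le
    rw [sub_add_cancel] at h3
    have h4 : p.k ≤ (1 + c) ^ (1 - p.α) := by
      rw [← hck]; exact Real.rpow_le_rpow hc0 (by linarith) h1.le
    have h5 : 0 ≤ y ^ p.α := Real.rpow_nonneg hy _
    nlinarith [mul_le_mul_of_nonneg_left h3 hk, mul_le_mul_of_nonneg_right h4 h5]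

lemma le_thetaLow_of_zero_mem_argmaxSet (hα : p.α ∈ Ioo (0 : ℝ) 1) (hk : 0 ≤ p.k) (hγ : 0 < p.γ)
    {θ : ℝ} (h : (0 : ℝ) ∈ p.argmaxSet θ 0) : θ ≤ p.thetaLow := by
  have h1 : 0 < 1 - p.α := by linarith [hα.2]
  have key : ∀ t : ℝ, 0 < t → t ^ p.α + p.k ≤ -θ * (1 + t) ^ p.α := by
    intro t ht
    have := h.2 (p.γ * (1 + t)) (by positivity)
    simp only [zero_mul, sub_zero] at this
    rw [F_zero hα hγ] at this
    unfold F at this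
    rw [U_of_nonneg (by nlinarith), show p.γ * (1 + t) - p.γ = p.γ * t by ring,
      Real.mul_rpow hγ.le ht.le, Real.mul_rpow hγ.le (by linarith)] at this
    have hg : 0 < p.γ ^ p.α := Real.rpow_pos_of_pos hγ _
    have h2 : p.γ ^ p.α * (t ^ p.α + p.k) ≤ p.γ ^ p.α * (-θ * (1 + t) ^ p.α) := by linarith
    exact le_of_mul_le_mul_left h2 hg
  rcases hk.eq_or_lt with hk0 | hkpos
  -- The equality case of Hölder is `t = 1/c`. For `k = 0` it escapes to infinity and is approached
  -- through `t = (1 - u)/u`, `u → 0`.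
  · have hlow : p.thetaLow = -1 := by
      unfold thetaLow
      rw [← hk0, Real.zero_rpow (by positivity)]
      simp
    rw [hlow]
    have hlim : Tendsto (fun u : ℝ => (1 - u) ^ p.α) (𝓝[>] 0) (𝓝 1) := by
      have : Continuous fun u : ℝ => (1 - u) ^ p.α :=
        (continuous_rpow_alpha hα).comp (continuous_const.sub continuous_id)
      simpa using (this.tendsto 0).mono_left nhdsWithin_le_nhds
    have : (1 : ℝ) ≤ -θ := by
      refine le_of_tendsto hlim ?_
      filter_upwards [Ioo_mem_nhdsGT (zero_lt_one (α := ℝ))] with u hu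
      have ht : 0 < (1 - u) / u := div_pos (by linarith [hu.2]) hu.1
      have h2 := key _ ht
      have h3 : 1 + (1 - u) / u = 1 / u := by field_simp [hu.1.ne']; ring
      rw [h3, ← hk0, Real.div_rpow (by linarith [hu.2]) hu.1.le, Real.div_rpow zero_le_one hu.1.le,
        Real.one_rpow] at h2
      have h4 : 0 < u ^ p.α := Real.rpow_pos_of_pos hu.1 _
      field_simp at h2
      linarith
    linarith
  · set c := p.k ^ (1 / (1 - p.α)) with hc
    have hc0 : 0 < c := Real.rpow_pos_of_pos hkpos _
    have hck : c ^ (1 - p.α) = p.k := by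
      rw [hc, ← Real.rpow_mul hk, one_div_mul_cancel h1.ne', Real.rpow_one]
    have hlow : p.thetaLow = -(1 + c) ^ (1 - p.α) := rfl
    have h2 := key (1 / c) (by positivity)
    have h3 : 1 + 1 / c = (1 + c) / c := by field_simp; ring
    rw [h3, Real.div_rpow zero_le_one hc0.le, Real.div_rpow (by linarith) hc0.le,
      Real.one_rpow] at h2
    have hca : 0 < c ^ p.α := Real.rpow_pos_of_pos hc0 _
    have hcc : c ^ p.α * p.k = c := by
      rw [← hck, ← Real.rpow_add hc0]; simp
    have hKa : 0 < (1 + c) ^ p.α := Real.rpow_pos_of_pos (by linarith) _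
    have hKK : (1 + c) ^ p.α * (1 + c) ^ (1 - p.α) = 1 + c := by
      rw [← Real.rpow_add (by linarith)]; simp
    have h4 : 1 + c ≤ -θ * (1 + c) ^ p.α := by
      have := mul_le_mul_of_nonneg_left h2 hca.le
      rw [mul_add, hcc] at this
      field_simp at this
      linarith
    rw [hlow]
    have : (1 + c) ^ p.α * (1 + c) ^ (1 - p.α) ≤ (1 + c) ^ p.α * -θ := by linarith
    linarith [le_of_mul_le_mul_left this hKa]

lemma argmaxSet_zero_subset_pair (hα : p.α ∈ Ioo (0 : ℝ) 1) (hk : 0 ≤ p.k) (hγ : 0 < p.γ)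
    {θ y : ℝ} (hy : y ∈ p.argmaxSet θ 0) (hpos : 0 < y) : p.argmaxSet θ 0 ⊆ {0, y} := by
  intro w hw
  rcases hw.1.eq_or_lt with h | h
  · exact Or.inl h.symm
  · exact Or.inr (eq_of_mem_argmaxSet_of_pos hα hk hγ hw h hy hpos)

/-- If `θ` were below `thetaLow`, raising it to `thetaLow` would strictly favour `y` over `0`, yet
`0` is still a maximizer there. -/
lemma eq_thetaLow_of_mem_argmaxSet (hα : p.α ∈ Ioo (0 : ℝ) 1) (hk : 0 ≤ p.k) (hγ : 0 < p.γ)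
    {θ y : ℝ} (h0 : (0 : ℝ) ∈ p.argmaxSet θ 0) (hy : y ∈ p.argmaxSet θ 0) (hpos : 0 < y) :
    θ = p.thetaLow := by
  refine le_antisymm (le_thetaLow_of_zero_mem_argmaxSet hα hk hγ h0) ?_
  have h1 := (zero_mem_argmaxSet_thetaLow hα hk hγ).2 y hpos.le
  have h2 := hy.2 0 le_rfl
  simp only [zero_mul, sub_zero, mul_zero] at h1 h2
  rw [F_zero hα hγ] at h1 h2
  unfold F at h1 h2
  have hya : 0 < y ^ p.α := Real.rpow_pos_of_pos hpos _
  by_contra! hlt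
  nlinarith [mul_lt_mul_of_pos_right hlt hya]

end Params

/-! ### A monotone selection of maximizers. -/

namespace Params

/-- A selection of maximizers of the Lagrangian `y ↦ F(y; θ) - x y`. -/
def argmaxSel (p : Params) (θ x : ℝ) : ℝ :=
  Classical.epsilon fun y => y ∈ p.argmaxSet θ x

variable {p : Params}

lemma argmaxSel_mem (hα : p.α ∈ Ioo (0 : ℝ) 1) (hk : 0 ≤ p.k) (hγ : 0 < p.γ) (θ : ℝ) {x : ℝ}
    (hx : 0 < x) : p.argmaxSel θ x ∈ p.argmaxSet θ x :=
  Classical.epsilon_spec (argmaxSet_nonempty hα hk hγ hx)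

/-- Writing prices as `exp u` gives a monotone function on all of `ℝ`, hence measurability and
countably many discontinuities. -/
lemma antitone_argmaxSel_exp (hα : p.α ∈ Ioo (0 : ℝ) 1) (hk : 0 ≤ p.k) (hγ : 0 < p.γ) (θ : ℝ) :
    Antitone fun u : ℝ => p.argmaxSel θ (Real.exp u) := by
  intro u v huv
  rcases huv.eq_or_lt with rfl | h
  · exact le_rfl
  · exact argmaxSet_antitone (Real.exp_lt_exp.2 h) (argmaxSel_mem hα hk hγ θ (Real.exp_pos _))
      (argmaxSel_mem hα hk hγ θ (Real.exp_pos _))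

/-- Any maximizer is squeezed between the selections at slightly lower and slightly higher prices.
-/
lemma argmaxSet_subset_of_continuousAt (hα : p.α ∈ Ioo (0 : ℝ) 1) (hk : 0 ≤ p.k) (hγ : 0 < p.γ)
    {θ u : ℝ} (h : ContinuousAt (fun u : ℝ => p.argmaxSel θ (Real.exp u)) u) :
    p.argmaxSet θ (Real.exp u) ⊆ {p.argmaxSel θ (Real.exp u)} := by
  intro y hy
  have hmem := fun v : ℝ => argmaxSel_mem hα hk hγ θ (Real.exp_pos v)
  refine le_antisymm ?_ ?_
  · refine ge_of_tendsto (h.tendsto.mono_left (nhdsWithin_le_nhds (s := Iio u))) ?_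
    filter_upwards [self_mem_nhdsWithin] with v hv
    exact argmaxSet_antitone (Real.exp_lt_exp.2 hv) (hmem v) hy
  · refine le_of_tendsto (h.tendsto.mono_left (nhdsWithin_le_nhds (s := Ioi u))) ?_
    filter_upwards [self_mem_nhdsWithin] with v hv
    exact argmaxSet_antitone (Real.exp_lt_exp.2 hv) hy (hmem v)

end Params

/-! ### The lognormal pricing kernel and the bounds it gives. -/

/-- The properties of the pricing kernel on which the portfolio problem depends. -/
structure KernelRegular {Ω : Type*} [mΩ : MeasurableSpace Ω] (P : Measure Ω) (B : ℝ≥0 → Ω → ℝ)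
    (p : Params) : Prop where
  hα : p.α ∈ Ioo (0 : ℝ) 1
  hk : 0 ≤ p.k
  hγ : 0 < p.γ
  augmented_le : augmented B P p.τ ≤ mΩ
  measurable_kernel : Measurable[augmented B P p.τ] (kernelZ B p p.τ)
  integrable_kernel : Integrable (kernelZ B p p.τ) P
  integrable_rpow : Integrable (fun ω => kernelZ B p p.τ ω ^ (-(p.α / (1 - p.α)))) P
  integral_rpow : ∫ ω, kernelZ B p p.τ ω ^ (-(p.α / (1 - p.α))) ∂P =
    Real.exp (p.h * p.τ) ^ (1 / (1 - p.α))
  measure_kernel_eq : ∀ c, P {ω | kernelZ B p p.τ ω = c} = 0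

lemma kernelZ_pos {Ω : Type*} (B : ℝ≥0 → Ω → ℝ) (p : Params) (t : ℝ≥0) (ω : Ω) :
    0 < kernelZ B p t ω :=
  Real.exp_pos _

section

variable {Ω : Type*} [mΩ : MeasurableSpace Ω] {P : Measure Ω} {B : ℝ≥0 → Ω → ℝ} {p : Params}

lemma measurable_kernelZ_augmented (P : Measure Ω) (B : ℝ≥0 → Ω → ℝ) (p : Params) (t : ℝ≥0) :
    Measurable[augmented B P t] (kernelZ B p t) := by
  have h : Measurable[augmented B P t] (B t) := by
    refine Measurable.mono (comap_measurable (B t)) ?_ le_rfl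
    refine le_trans ?_ le_sup_left
    exact le_iSup₂_of_le t (mem_Iic.2 le_rfl) le_rfl
  unfold kernelZ
  fun_prop

/-- Each `B s` is only almost everywhere measurable; completeness makes it measurable and includes
the null sets. -/
lemma augmented_le_of_isComplete [P.IsComplete] (hB : ∀ t, AEMeasurable (B t) P) (t : ℝ≥0) :
    augmented B P t ≤ mΩ := by
  refine sup_le (iSup₂_le fun s _ => ?_) (MeasurableSpace.generateFrom_le fun N hN => ?_)
  · exact ((hB s).nullMeasurable.measurable_of_complete).comap_le
  · exact Measure.IsComplete.out' N hN

/-- The moments are values of the Gaussian moment generating function. Since `φ ≠ 0` and `τ > 0`,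
level sets of the kernel lie in level sets of a nondegenerate Gaussian, hence are null. -/
lemma kernelRegular [IsProbabilityMeasure P] [P.IsComplete] (hB : IsBrownianReal B P)
    (hφ : p.φ ≠ 0) (hτ : 0 < p.τ) (hα : p.α ∈ Ioo (0 : ℝ) 1) (hk : 0 ≤ p.k) (hγ : 0 < p.γ) :
    KernelRegular P B p := by
  have hlaw := hB.toIsPreBrownianReal.hasLaw_eval p.τ
  have hmap : P.map (B p.τ) = gaussianReal 0 p.τ := hlaw.map_eq
  have hexp : ∀ t : ℝ, Integrable (fun ω => Real.exp (t * B p.τ ω)) P := fun t => by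
    have h := integrable_exp_mul_gaussianReal (μ := 0) (v := p.τ) t
    rw [← hmap] at h
    exact h.comp_aemeasurable hlaw.aemeasurable
  have hmgf : ∀ t : ℝ, ∫ ω, Real.exp (t * B p.τ ω) ∂P = Real.exp (p.τ * t ^ 2 / 2) := fun t => by
    have := mgf_gaussianReal hmap t
    simpa [mgf] using this
  have h1 : 0 < 1 - p.α := by linarith [hα.2]
  have hpow : (fun ω => kernelZ B p p.τ ω ^ (-(p.α / (1 - p.α)))) = fun ω =>
      Real.exp (p.α / (1 - p.α) * p.φ * B p.τ ω) *
        Real.exp (p.α / (1 - p.α) * ((p.r + p.φ ^ 2 / 2) * p.τ)) := by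
    funext ω
    rw [kernelZ, ← Real.exp_mul, ← Real.exp_add]
    ring_nf
  refine ⟨hα, hk, hγ, augmented_le_of_isComplete hB.toIsPreBrownianReal.aemeasurable _,
    measurable_kernelZ_augmented _ _ _ _, ?_, ?_, ?_, ?_⟩
  · have : kernelZ B p p.τ = fun ω => Real.exp (-p.φ * B p.τ ω) *
        Real.exp (-((p.r + p.φ ^ 2 / 2) * p.τ)) := by
      funext ω
      rw [kernelZ, ← Real.exp_add, sub_eq_add_neg]
    rw [this]
    exact (hexp _).mul_const _
  · rw [hpow]
    exact (hexp _).mul_const _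
  · rw [hpow, integral_mul_const, hmgf, ← Real.exp_mul, ← Real.exp_add]
    congr 1
    unfold Params.h
    field_simp
    ring
  · intro c
    rcases le_or_gt c 0 with hc | hc
    · convert measure_empty (μ := P)
      ext ω
      simp only [mem_ofPred_eq, mem_empty_iff_false, iff_false]
      exact (hc.trans_lt (kernelZ_pos B p p.τ ω)).ne'
    · have hsub : {ω | kernelZ B p p.τ ω = c} ⊆
          B p.τ ⁻¹' {-(Real.log c + (p.r + p.φ ^ 2 / 2) * p.τ) / p.φ} := by
        intro ω hω
        have : kernelZ B p p.τ ω = c := hω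
        have h2 : -p.φ * B p.τ ω - (p.r + p.φ ^ 2 / 2) * p.τ = Real.log c := by
          rw [← this, kernelZ, Real.log_exp]
        rw [mem_preimage, mem_singleton_iff, eq_div_iff hφ]
        linarith
      refine measure_mono_null hsub ?_
      have := nullSingletonClass_gaussianReal (μ := 0) hτ.ne'
      rw [← Measure.map_apply_of_aemeasurable hlaw.aemeasurable (measurableSet_singleton _), hmap]
      exact measure_singleton _

namespace KernelRegular

lemma one_sub_pos (M : KernelRegular P B p) : 0 < 1 - p.α := by linarith [M.hα.2]

lemma measurable (M : KernelRegular P B p) : Measurable (kernelZ B p p.τ) :=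
  M.measurable_kernel.mono M.augmented_le le_rfl

lemma measurable_of_augmented (M : KernelRegular P B p) {Y : Ω → ℝ}
    (hY : Measurable[augmented B P p.τ] Y) : Measurable Y :=
  hY.mono M.augmented_le le_rfl

lemma measurable_of_mem (M : KernelRegular P B p) {Y : Ω → ℝ} (hY : Y ∈ returns P B p) :
    Measurable Y :=
  M.measurable_of_augmented hY.1

lemma measurable_argmaxSel (M : KernelRegular P B p) (θ : ℝ) {l : ℝ} (hl : 0 < l) :
    Measurable[augmented B P p.τ] fun ω => p.argmaxSel θ (l * kernelZ B p p.τ ω) := by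
  have h1 : Measurable fun u : ℝ => p.argmaxSel θ (Real.exp u) :=
    (Params.antitone_argmaxSel_exp M.hα M.hk M.hγ θ).measurable
  have h2 : Measurable[augmented B P p.τ] fun ω => Real.log (l * kernelZ B p p.τ ω) :=
    (Real.measurable_log.comp (measurable_const_mul l)).comp M.measurable_kernel
  have h3 := h1.comp h2
  convert h3 using 2 with ω
  simp [Real.exp_log (mul_pos hl (kernelZ_pos B p p.τ ω))]

/-- Non-uniqueness can occur only at the countably many discontinuities of the selection, and the
kernel charges no point. -/
lemma ae_argmaxSet_subset (M : KernelRegular P B p) (θ : ℝ) {l : ℝ} (hl : 0 < l) :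
    ∀ᵐ ω ∂P, p.argmaxSet θ (l * kernelZ B p p.τ ω) ⊆
      {p.argmaxSel θ (l * kernelZ B p p.τ ω)} := by
  have hcount := (Params.antitone_argmaxSel_exp M.hα M.hk M.hγ θ).countable_not_continuousAt
  have hnull : ∀ᵐ ω ∂P, ∀ u ∈ {u | ¬ContinuousAt (fun u : ℝ => p.argmaxSel θ (Real.exp u)) u},
      Real.log (l * kernelZ B p p.τ ω) ≠ u := by
    rw [ae_ball_iff hcount]
    intro u _
    refine measure_mono_null ?_ (M.measure_kernel_eq (Real.exp u / l))
    intro ω hω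
    have hω' : Real.log (l * kernelZ B p p.τ ω) = u := by simpa using hω
    have hpos := mul_pos hl (kernelZ_pos B p p.τ ω)
    change kernelZ B p p.τ ω = Real.exp u / l
    rw [← hω', Real.exp_log hpos]
    field_simp
  filter_upwards [hnull] with ω hω
  have hcont : ContinuousAt (fun u : ℝ => p.argmaxSel θ (Real.exp u))
      (Real.log (l * kernelZ B p p.τ ω)) := by
    by_contra h
    exact hω _ h rfl
  have := Params.argmaxSet_subset_of_continuousAt M.hα M.hk M.hγ hcont
  rwa [Real.exp_log (mul_pos hl (kernelZ_pos B p p.τ ω))] at this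

/-- The Hölder bound `y^α ≤ K (α z y + (1 - α) K^{-1/(1-α)} z^{-α/(1-α)})`. -/
lemma rpow_le_weighted {a y z K : ℝ} (ha : a ∈ Ioo (0 : ℝ) 1) (hy : 0 ≤ y) (hz : 0 < z)
    (hK : 0 < K) :
    y ^ a ≤ K * (a * (z * y) + (1 - a) * (z ^ (-(a / (1 - a))) / K ^ (1 / (1 - a)))) := by
  have h1 : 0 < 1 - a := by linarith [ha.2]
  have h := Real.geom_mean_le_arith_mean2_weighted (w₁ := a) (w₂ := 1 - a) (p₁ := z * y)
    (p₂ := z ^ (-(a / (1 - a))) / K ^ (1 / (1 - a))) ha.1.le h1.le (by positivity)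
    (by positivity) (by ring)
  refine le_trans (le_of_eq ?_) (mul_le_mul_of_nonneg_left h hK.le)
  rw [Real.mul_rpow hz.le hy, Real.div_rpow (by positivity) (by positivity),
    ← Real.rpow_mul hz.le, ← Real.rpow_mul hK.le, one_div_mul_cancel h1.ne', Real.rpow_one,
    neg_mul, div_mul_cancel₀ _ h1.ne', Real.rpow_neg hz.le]
  have : 0 < z ^ a := Real.rpow_pos_of_pos hz _
  field_simp

lemma integrable_weighted (M : KernelRegular P B p) {Y : Ω → ℝ} (hY : Y ∈ returns P B p) :
    Integrable (fun ω => Real.exp (p.h * p.τ) * (p.α * (kernelZ B p p.τ ω * Y ω) + (1 - p.α) *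
      (kernelZ B p p.τ ω ^ (-(p.α / (1 - p.α))) / Real.exp (p.h * p.τ) ^ (1 / (1 - p.α))))) P :=
  (((hY.2.2.1.const_mul _).add ((M.integrable_rpow.div_const _).const_mul _)).const_mul _)

lemma integrable_rpow_returns (M : KernelRegular P B p) {Y : Ω → ℝ} (hY : Y ∈ returns P B p) :
    Integrable (fun ω => Y ω ^ p.α) P := by
  refine (M.integrable_weighted hY).mono'
    ((Params.continuous_rpow_alpha M.hα).measurable.comp
      (M.measurable_of_mem hY)).aestronglyMeasurable (ae_of_all _ fun ω => ?_)
  rw [Real.norm_of_nonneg (Real.rpow_nonneg (hY.2.1 ω) _)]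
  exact rpow_le_weighted M.hα (hY.2.1 ω) (kernelZ_pos _ _ _ _) (Real.exp_pos _)

/-- With `K = e^{hτ}` the weighted bound integrates to at most `K (α + (1 - α))`. -/
lemma integral_rpow_mem_Icc (M : KernelRegular P B p) {Y : Ω → ℝ}
    (hY : Y ∈ returns P B p) : ∫ ω, Y ω ^ p.α ∂P ∈ Icc 0 (Real.exp (p.h * p.τ)) := by
  refine ⟨integral_nonneg fun ω => Real.rpow_nonneg (hY.2.1 ω) _, ?_⟩
  have h := integral_mono (M.integrable_rpow_returns hY) (M.integrable_weighted hY) fun ω =>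
    rpow_le_weighted M.hα (hY.2.1 ω) (kernelZ_pos B p p.τ ω) (Real.exp_pos (p.h * p.τ))
  refine h.trans ?_
  rw [integral_const_mul, integral_add (hY.2.2.1.const_mul _)
    ((M.integrable_rpow.div_const _).const_mul _), integral_const_mul, integral_const_mul,
    integral_div, M.integral_rpow, div_self (by positivity)]
  have := mul_le_mul_of_nonneg_left hY.2.2.2 M.hα.1.le
  nlinarith [Real.exp_pos (p.h * p.τ)]

lemma integrable_F [IsProbabilityMeasure P] (M : KernelRegular P B p) {Y : Ω → ℝ}
    (hm : Measurable Y) (h0 : ∀ ω, 0 ≤ Y ω) (hi : Integrable (fun ω => Y ω ^ p.α) P) (θ : ℝ) :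
    Integrable (fun ω => p.F (Y ω) θ) P := by
  unfold Params.F
  refine Integrable.add ?_ (hi.const_mul θ)
  refine ((integrable_const (p.k * p.γ ^ p.α)).add hi).mono'
    ((Params.continuous_U M.hα).measurable.comp (hm.sub_const _)).aestronglyMeasurable
    (ae_of_all _ fun ω => ?_)
  exact Params.abs_U_sub_le M.hα M.hk M.hγ (h0 ω)

lemma integral_F_add [IsProbabilityMeasure P] (M : KernelRegular P B p) {Y : Ω → ℝ}
    (hm : Measurable Y) (h0 : ∀ ω, 0 ≤ Y ω) (hi : Integrable (fun ω => Y ω ^ p.α) P) (θ c : ℝ) :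
    ∫ ω, p.F (Y ω) (θ + c) ∂P = ∫ ω, p.F (Y ω) θ ∂P + c * ∫ ω, Y ω ^ p.α ∂P := by
  simp_rw [Params.F_add]
  rw [integral_add (M.integrable_F hm h0 hi θ) (hi.const_mul c), integral_const_mul]

/-! ### Random variables dominated by a power of the kernel -/

lemma rpow_kernel_rpow {Ω : Type*} (B : ℝ≥0 → Ω → ℝ) (p : Params) (ω : Ω) :
    (kernelZ B p p.τ ω ^ (-(1 / (1 - p.α)))) ^ p.α =
      kernelZ B p p.τ ω ^ (-(p.α / (1 - p.α))) := by
  rw [← Real.rpow_mul (kernelZ_pos _ _ _ _).le]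
  congr 1
  ring

lemma kernel_mul_rpow_kernel (M : KernelRegular P B p) (ω : Ω) :
    kernelZ B p p.τ ω * kernelZ B p p.τ ω ^ (-(1 / (1 - p.α))) =
      kernelZ B p p.τ ω ^ (-(p.α / (1 - p.α))) := by
  have := M.one_sub_pos
  nth_rw 1 [← Real.rpow_one (kernelZ B p p.τ ω)]
  rw [← Real.rpow_add (kernelZ_pos _ _ _ _)]
  congr 1
  field_simp
  ring

lemma argmaxSel_mem (M : KernelRegular P B p) (θ : ℝ) {l : ℝ} (hl : 0 < l) (ω : Ω) :
    p.argmaxSel θ (l * kernelZ B p p.τ ω) ∈ p.argmaxSet θ (l * kernelZ B p p.τ ω) :=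
  Params.argmaxSel_mem M.hα M.hk M.hγ θ (mul_pos hl (kernelZ_pos _ _ _ _))

/-- Uniform in `l ≥ l'` and `|θ| ≤ b`, hence a dominating function when the multiplier or `θ`
varies. -/
lemma argmaxSel_le (M : KernelRegular P B p) {θ l l' b : ℝ} (hl' : 0 < l') (hl : l' ≤ l)
    (hb : |θ| ≤ b) (ω : Ω) :
    p.argmaxSel θ (l * kernelZ B p p.τ ω) ≤
      ((1 + p.k + b) / l') ^ (1 / (1 - p.α)) * kernelZ B p p.τ ω ^ (-(1 / (1 - p.α))) := by
  have hz := kernelZ_pos B p p.τ ω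
  have h1 := M.one_sub_pos
  have hk := M.hk
  have hl0 : 0 < l := hl'.trans_le hl
  have hb0 : 0 ≤ b := (abs_nonneg θ).trans hb
  refine (Params.argmaxSet_le M.hα M.hk M.hγ (mul_pos hl0 hz) (M.argmaxSel_mem θ hl0 ω)).trans ?_
  rw [Real.rpow_neg hz.le, ← Real.inv_rpow hz.le, ← Real.mul_rpow (by positivity) (by positivity)]
  refine Real.rpow_le_rpow (by positivity) ?_ (by positivity)
  rw [← div_eq_mul_inv, div_div]
  gcongr

lemma integrable_rpow_of_le (M : KernelRegular P B p) {Y : Ω → ℝ} {C : ℝ} (hC : 0 ≤ C)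
    (hm : Measurable Y) (h0 : ∀ ω, 0 ≤ Y ω)
    (h : ∀ ω, Y ω ≤ C * kernelZ B p p.τ ω ^ (-(1 / (1 - p.α)))) :
    Integrable (fun ω => Y ω ^ p.α) P := by
  refine (M.integrable_rpow.const_mul (C ^ p.α)).mono'
    ((Params.continuous_rpow_alpha M.hα).measurable.comp hm).aestronglyMeasurable
    (ae_of_all _ fun ω => ?_)
  rw [Real.norm_of_nonneg (Real.rpow_nonneg (h0 ω) _), ← rpow_kernel_rpow,
    ← Real.mul_rpow hC (Real.rpow_nonneg (kernelZ_pos _ _ _ _).le _)]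
  exact Real.rpow_le_rpow (h0 ω) (h ω) M.hα.1.le

lemma integrable_kernel_mul_of_le (M : KernelRegular P B p) {Y : Ω → ℝ} {C : ℝ}
    (hm : Measurable Y) (h0 : ∀ ω, 0 ≤ Y ω)
    (h : ∀ ω, Y ω ≤ C * kernelZ B p p.τ ω ^ (-(1 / (1 - p.α)))) :
    Integrable (fun ω => kernelZ B p p.τ ω * Y ω) P := by
  refine (M.integrable_rpow.const_mul C).mono' (M.measurable.mul hm).aestronglyMeasurable
    (ae_of_all _ fun ω => ?_)
  have hz := kernelZ_pos B p p.τ ω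
  rw [Real.norm_of_nonneg (mul_nonneg hz.le (h0 ω)), ← M.kernel_mul_rpow_kernel]
  calc _ ≤ _ := mul_le_mul_of_nonneg_left (h ω) hz.le
    _ = _ := by ring

lemma measurable_argmaxSel' (M : KernelRegular P B p) (θ : ℝ) {l : ℝ} (hl : 0 < l) :
    Measurable fun ω => p.argmaxSel θ (l * kernelZ B p p.τ ω) :=
  M.measurable_of_augmented (M.measurable_argmaxSel θ hl)

lemma integrable_argmaxSel_rpow (M : KernelRegular P B p) (θ : ℝ) {l : ℝ} (hl : 0 < l) :
    Integrable (fun ω => p.argmaxSel θ (l * kernelZ B p p.τ ω) ^ p.α) P :=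
  M.integrable_rpow_of_le (Real.rpow_nonneg (by have := M.hk; positivity) _)
    (M.measurable_argmaxSel' θ hl)
    (fun ω => (M.argmaxSel_mem θ hl ω).1) (M.argmaxSel_le hl le_rfl le_rfl)

lemma integrable_kernel_mul_argmaxSel (M : KernelRegular P B p) (θ : ℝ) {l : ℝ} (hl : 0 < l) :
    Integrable (fun ω => kernelZ B p p.τ ω * p.argmaxSel θ (l * kernelZ B p p.τ ω)) P :=
  M.integrable_kernel_mul_of_le (M.measurable_argmaxSel' θ hl)
    (fun ω => (M.argmaxSel_mem θ hl ω).1) (M.argmaxSel_le hl le_rfl le_rfl)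

lemma integrable_F_argmaxSel [IsProbabilityMeasure P] (M : KernelRegular P B p) (θ θ' : ℝ) {l : ℝ}
    (hl : 0 < l) :
    Integrable (fun ω => p.F (p.argmaxSel θ (l * kernelZ B p p.τ ω)) θ') P :=
  M.integrable_F (M.measurable_argmaxSel' θ hl) (fun ω => (M.argmaxSel_mem θ hl ω).1)
    (M.integrable_argmaxSel_rpow θ hl) θ'

end KernelRegular

end

/-! ### Convexity of `Φ` and Lagrangian duality. -/

section

variable {Ω : Type*} [mΩ : MeasurableSpace Ω]

/-- The subdifferential of `Φ` at `θ`. -/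
def subgradients (P : Measure Ω) (B : ℝ≥0 → Ω → ℝ) (p : Params) (θ : ℝ) : Set ℝ :=
  {s | ∀ θ', Phi P B p θ + s * (θ' - θ) ≤ Phi P B p θ'}

/-- The cost `E[Z I(lZ)]` of the pointwise optimizer for the multiplier `l`. -/
def selectionCost (P : Measure Ω) (B : ℝ≥0 → Ω → ℝ) (p : Params) (θ l : ℝ) : ℝ :=
  ∫ ω, kernelZ B p p.τ ω * p.argmaxSel θ (l * kernelZ B p p.τ ω) ∂P

end

namespace KernelRegular

variable {Ω : Type*} [mΩ : MeasurableSpace Ω] {P : Measure Ω} [IsProbabilityMeasure P]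
  {B : ℝ≥0 → Ω → ℝ} {p : Params}

lemma integrable_F_returns (M : KernelRegular P B p) {Y : Ω → ℝ} (hY : Y ∈ returns P B p)
    (θ : ℝ) : Integrable (fun ω => p.F (Y ω) θ) P :=
  M.integrable_F (M.measurable_of_mem hY) hY.2.1 (M.integrable_rpow_returns hY) θ

lemma integral_F_returns_add (M : KernelRegular P B p) {Y : Ω → ℝ} (hY : Y ∈ returns P B p)
    (θ c : ℝ) :
    ∫ ω, p.F (Y ω) (θ + c) ∂P = ∫ ω, p.F (Y ω) θ ∂P + c * ∫ ω, Y ω ^ p.α ∂P :=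
  M.integral_F_add (M.measurable_of_mem hY) hY.2.1 (M.integrable_rpow_returns hY) θ c

lemma const_mem_returns (M : KernelRegular P B p) {y : ℝ} (hy : 0 ≤ y)
    (h : y * ∫ ω, kernelZ B p p.τ ω ∂P ≤ 1) : (fun _ => y) ∈ returns P B p := by
  refine ⟨measurable_const, fun _ => hy, M.integrable_kernel.mul_const y, ?_⟩
  rw [integral_mul_const, mul_comm]
  exact h

lemma returns_nonempty (M : KernelRegular P B p) : (returns P B p).Nonempty :=
  ⟨_, M.const_mem_returns le_rfl (by simp)⟩

lemma bddAbove (M : KernelRegular P B p) (θ : ℝ) :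
    BddAbove ((fun Y : Ω → ℝ => ∫ ω, p.F (Y ω) θ ∂P) '' returns P B p) := by
  refine ⟨p.F 0 θ + (1 + p.k + |θ|) * Real.exp (p.h * p.τ), ?_⟩
  rintro _ ⟨Y, hY, rfl⟩
  have hi := (M.integrable_rpow_returns hY).const_mul (1 + p.k + |θ|)
  have h := integral_mono (M.integrable_F_returns hY θ) ((integrable_const (p.F 0 θ)).add hi)
    fun ω => Params.F_le M.hα M.hk M.hγ θ (hY.2.1 ω)
  refine h.trans ?_
  simp only [Pi.add_apply]
  rw [integral_add (integrable_const _) hi, integral_const_mul]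
  simp only [integral_const, probReal_univ, smul_eq_mul, one_mul]
  have := M.hk
  have := mul_le_mul_of_nonneg_left (M.integral_rpow_mem_Icc hY).2
    (by positivity : 0 ≤ 1 + p.k + |θ|)
  linarith

lemma le_Phi (M : KernelRegular P B p) {Y : Ω → ℝ} (hY : Y ∈ returns P B p) (θ : ℝ) :
    ∫ ω, p.F (Y ω) θ ∂P ≤ Phi P B p θ :=
  le_csSup (M.bddAbove θ) ⟨Y, hY, rfl⟩

lemma Phi_le (M : KernelRegular P B p) {θ c : ℝ}
    (h : ∀ Y ∈ returns P B p, ∫ ω, p.F (Y ω) θ ∂P ≤ c) : Phi P B p θ ≤ c :=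
  csSup_le (M.returns_nonempty.image _) (by rintro _ ⟨Y, hY, rfl⟩; exact h Y hY)

lemma Phi_mono (M : KernelRegular P B p) {θ θ' : ℝ} (h : θ ≤ θ') :
    Phi P B p θ ≤ Phi P B p θ' := by
  refine M.Phi_le fun Y hY => ?_
  have h1 := M.le_Phi hY θ'
  have h2 := M.integral_F_returns_add hY θ (θ' - θ)
  rw [add_sub_cancel] at h2
  nlinarith [(M.integral_rpow_mem_Icc hY).1]

lemma Phi_le_add (M : KernelRegular P B p) {θ θ' : ℝ} (h : θ ≤ θ') :
    Phi P B p θ' ≤ Phi P B p θ + Real.exp (p.h * p.τ) * (θ' - θ) := by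
  refine M.Phi_le fun Y hY => ?_
  have h1 := M.le_Phi hY θ
  have h2 := M.integral_F_returns_add hY θ (θ' - θ)
  rw [add_sub_cancel] at h2
  have := mul_le_mul_of_nonneg_left (M.integral_rpow_mem_Icc hY).2 (sub_nonneg.2 h)
  linarith

lemma abs_Phi_sub_le (M : KernelRegular P B p) (θ θ' : ℝ) :
    |Phi P B p θ - Phi P B p θ'| ≤ Real.exp (p.h * p.τ) * |θ - θ'| := by
  rcases le_total θ θ' with h | h
  · rw [abs_sub_comm, abs_sub_comm θ, abs_of_nonneg (sub_nonneg.2 h),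
      abs_of_nonneg (sub_nonneg.2 (M.Phi_mono h))]
    linarith [M.Phi_le_add h]
  · rw [abs_of_nonneg (sub_nonneg.2 h), abs_of_nonneg (sub_nonneg.2 (M.Phi_mono h))]
    linarith [M.Phi_le_add h]

lemma continuous_Phi (M : KernelRegular P B p) : Continuous (Phi P B p) := by
  refine LipschitzWith.continuous (K := ⟨Real.exp (p.h * p.τ), (Real.exp_pos _).le⟩) ?_
  refine LipschitzWith.of_dist_le_mul fun x y => ?_
  exact M.abs_Phi_sub_le x y

lemma subgradients_subset_Icc (M : KernelRegular P B p) (θ : ℝ) :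
    subgradients P B p θ ⊆ Icc 0 (Real.exp (p.h * p.τ)) := by
  intro s hs
  constructor
  · have h1 := hs (θ - 1)
    have h2 := M.Phi_mono (by linarith : θ - 1 ≤ θ)
    linarith
  · have h1 := hs (θ + 1)
    have h2 := M.Phi_le_add (by linarith : θ ≤ θ + 1)
    linarith

/-- The affine function of an optimizer touches `Φ` at `θ` and stays below it elsewhere. -/
lemma optimalMoments_subset_subgradients (M : KernelRegular P B p) (θ : ℝ) :
    optimalMoments P B p (fun y => p.F y θ) ⊆ subgradients P B p θ := by
  rintro _ ⟨Y, ⟨hY, hopt⟩, rfl⟩ θ'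
  have h1 : Phi P B p θ ≤ ∫ ω, p.F (Y ω) θ ∂P := M.Phi_le hopt
  have h2 := M.integral_F_returns_add hY θ (θ' - θ)
  rw [add_sub_cancel] at h2
  have h3 := M.le_Phi hY θ'
  simp only
  linarith

/-- Weak duality. -/
lemma Phi_le_dual (M : KernelRegular P B p) (θ : ℝ) {l : ℝ} (hl : 0 < l) :
    Phi P B p θ ≤ ∫ ω, p.F (p.argmaxSel θ (l * kernelZ B p p.τ ω)) θ ∂P
      - l * selectionCost P B p θ l + l := by
  refine M.Phi_le fun Y hY => ?_
  have hZY := hY.2.2.1.const_mul l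
  have hZI := (M.integrable_kernel_mul_argmaxSel θ hl).const_mul l
  have h := integral_mono ((M.integrable_F_returns hY θ).sub hZY)
    ((M.integrable_F_argmaxSel θ θ hl).sub hZI) fun ω => by
      have := (M.argmaxSel_mem θ hl ω).2 (Y ω) (hY.2.1 ω)
      simp only [Pi.sub_apply]
      linarith
  simp only [Pi.sub_apply] at h
  rw [integral_sub (M.integrable_F_returns hY θ) hZY,
    integral_sub (M.integrable_F_argmaxSel θ θ hl) hZI, integral_const_mul,
    integral_const_mul] at h
  have h2 := mul_le_mul_of_nonneg_left hY.2.2.2 hl.le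
  unfold selectionCost
  linarith

/-! ### Binding budget constraint -/

lemma argmaxSel_mem_returns (M : KernelRegular P B p) {θ l : ℝ} (hl : 0 < l)
    (h : selectionCost P B p θ l = 1) :
    (fun ω => p.argmaxSel θ (l * kernelZ B p p.τ ω)) ∈ returns P B p :=
  ⟨M.measurable_argmaxSel θ hl, fun ω => (M.argmaxSel_mem θ hl ω).1,
    M.integrable_kernel_mul_argmaxSel θ hl, h.le⟩

/-- At cost 1 the multiplier terms in the weak duality bound cancel: there is no duality gap. -/
lemma argmaxSel_mem_optimizers (M : KernelRegular P B p) {θ l : ℝ} (hl : 0 < l)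
    (h : selectionCost P B p θ l = 1) :
    (fun ω => p.argmaxSel θ (l * kernelZ B p p.τ ω)) ∈ optimizers P B p (fun y => p.F y θ) := by
  refine ⟨M.argmaxSel_mem_returns hl h, fun Y hY => ?_⟩
  have h1 := (M.le_Phi hY θ).trans (M.Phi_le_dual θ hl)
  rw [h] at h1
  simpa using h1

/-- Where the maximizer is unique, which is almost surely, the closed graph forces the selections to
converge; domination does the rest. -/
lemma tendsto_integral_argmaxSel_rpow (M : KernelRegular P B p) (θ : ℝ) {l : ℝ} (hl : 0 < l) :
    Tendsto (fun θ' => ∫ ω, p.argmaxSel θ' (l * kernelZ B p p.τ ω) ^ p.α ∂P) (𝓝 θ)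
      (𝓝 (∫ ω, p.argmaxSel θ (l * kernelZ B p p.τ ω) ^ p.α ∂P)) := by
  have hk := M.hk
  set C := ((1 + p.k + (|θ| + 1)) / l) ^ (1 / (1 - p.α)) with hC
  have hC0 : 0 ≤ C := Real.rpow_nonneg (by positivity) _
  have hev : ∀ᶠ θ' in 𝓝 θ, |θ'| ≤ |θ| + 1 := by
    have : Tendsto (fun θ' : ℝ => |θ'|) (𝓝 θ) (𝓝 |θ|) := continuous_abs.tendsto θ
    exact (this.eventually (gt_mem_nhds (by linarith : |θ| < |θ| + 1))).mono fun _ h => h.le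
  refine tendsto_integral_filter_of_dominated_convergence
    (fun ω => C ^ p.α * kernelZ B p p.τ ω ^ (-(p.α / (1 - p.α)))) ?_ ?_
    (M.integrable_rpow.const_mul _) ?_
  · exact Eventually.of_forall fun θ' => (M.integrable_argmaxSel_rpow θ' hl).aestronglyMeasurable
  · filter_upwards [hev] with θ' hθ'
    refine ae_of_all _ fun ω => ?_
    have h0 := (M.argmaxSel_mem θ' hl ω).1
    rw [Real.norm_of_nonneg (Real.rpow_nonneg h0 _), ← rpow_kernel_rpow,
      ← Real.mul_rpow hC0 (Real.rpow_nonneg (kernelZ_pos _ _ _ _).le _)]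
    exact Real.rpow_le_rpow h0 (M.argmaxSel_le hl le_rfl hθ' ω) M.hα.1.le
  · filter_upwards [M.ae_argmaxSet_subset θ hl] with ω hω
    refine ((Params.continuous_rpow_alpha M.hα).tendsto _).comp ?_
    refine Params.tendsto_of_argmaxSet_subset
      (b := C * kernelZ B p p.τ ω ^ (-(1 / (1 - p.α)))) M.hα tendsto_id tendsto_const_nhds
      (Eventually.of_forall fun θ' => M.argmaxSel_mem θ' hl ω) ?_ hω
    exact hev.mono fun θ' hθ' => M.argmaxSel_le hl le_rfl hθ' ω

/-- Envelope argument: with `l` frozen, the dual value dominates `Φ` and agrees with it at `θ`, so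
its derivative there is the only possible subgradient. -/
lemma eq_of_mem_subgradients_of_selectionCost (M : KernelRegular P B p) {θ l s : ℝ} (hl : 0 < l)
    (h : selectionCost P B p θ l = 1) (hs : s ∈ subgradients P B p θ) :
    s = ∫ ω, p.argmaxSel θ (l * kernelZ B p p.τ ω) ^ p.α ∂P := by
  have hopt := M.le_Phi (M.argmaxSel_mem_returns hl h) θ
  have key : ∀ θ', s * (θ' - θ) ≤
      (θ' - θ) * ∫ ω, p.argmaxSel θ' (l * kernelZ B p p.τ ω) ^ p.α ∂P := by
    intro θ'
    have h1 := M.Phi_le_dual θ' hl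
    have h2 := hs θ'
    have h3 := M.integral_F_add (M.measurable_argmaxSel' θ' hl)
      (fun ω => (M.argmaxSel_mem θ' hl ω).1) (M.integrable_argmaxSel_rpow θ' hl) θ (θ' - θ)
    rw [add_sub_cancel] at h3
    have hZ := (M.integrable_kernel_mul_argmaxSel θ hl).const_mul l
    have hZ' := (M.integrable_kernel_mul_argmaxSel θ' hl).const_mul l
    have h4 := integral_mono ((M.integrable_F_argmaxSel θ' θ hl).sub hZ')
      ((M.integrable_F_argmaxSel θ θ hl).sub hZ) fun ω => by
        have := (M.argmaxSel_mem θ hl ω).2 _ (M.argmaxSel_mem θ' hl ω).1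
        simp only [Pi.sub_apply]
        linarith
    simp only [Pi.sub_apply] at h4
    rw [integral_sub (M.integrable_F_argmaxSel θ' θ hl) hZ',
      integral_sub (M.integrable_F_argmaxSel θ θ hl) hZ, integral_const_mul,
      integral_const_mul] at h4
    unfold selectionCost at h1 h
    rw [h] at h4
    linarith
  have hlim := M.tendsto_integral_argmaxSel_rpow θ hl
  refine le_antisymm ?_ ?_
  · refine ge_of_tendsto (hlim.mono_left (nhdsWithin_le_nhds (s := Ioi θ))) ?_
    filter_upwards [self_mem_nhdsWithin] with θ' hθ'
    have hpos : 0 < θ' - θ := sub_pos.2 hθ'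
    exact le_of_mul_le_mul_left (by linarith [key θ']) hpos
  · refine le_of_tendsto (hlim.mono_left (nhdsWithin_le_nhds (s := Iio θ))) ?_
    filter_upwards [self_mem_nhdsWithin] with θ' hθ'
    have hpos : 0 < θ - θ' := sub_pos.2 hθ'
    exact le_of_mul_le_mul_left (by linarith [key θ']) hpos

lemma continuousAt_selectionCost (M : KernelRegular P B p) (θ : ℝ) {l : ℝ} (hl : 0 < l) :
    ContinuousAt (selectionCost P B p θ) l := by
  have hk := M.hk
  -- Multipliers near `l` stay above `l / 2`, away from `0` where the bound on maximizers blows up.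
  have hl2 : 0 < l / 2 := by positivity
  set C := ((1 + p.k + |θ|) / (l / 2)) ^ (1 / (1 - p.α)) with hC
  have hev : ∀ᶠ l' in 𝓝 l, l / 2 ≤ l' :=
    (lt_mem_nhds (by linarith : l / 2 < l)).mono fun _ h => h.le
  refine tendsto_integral_filter_of_dominated_convergence
    (fun ω => C * kernelZ B p p.τ ω ^ (-(p.α / (1 - p.α)))) ?_ ?_
    (M.integrable_rpow.const_mul _) ?_
  · filter_upwards [hev] with l' hl'
    exact (M.integrable_kernel_mul_argmaxSel θ (hl2.trans_le hl')).aestronglyMeasurable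
  · filter_upwards [hev] with l' hl'
    refine ae_of_all _ fun ω => ?_
    have hz := kernelZ_pos B p p.τ ω
    have h0 := (M.argmaxSel_mem θ (hl2.trans_le hl') ω).1
    rw [Real.norm_of_nonneg (mul_nonneg hz.le h0), ← M.kernel_mul_rpow_kernel]
    calc _ ≤ _ := mul_le_mul_of_nonneg_left (M.argmaxSel_le hl2 hl' le_rfl ω) hz.le
      _ = _ := by ring
  · filter_upwards [M.ae_argmaxSet_subset θ hl] with ω hω
    refine tendsto_const_nhds.mul ?_
    refine Params.tendsto_of_argmaxSet_subset
      (b := C * kernelZ B p p.τ ω ^ (-(1 / (1 - p.α)))) M.hα tendsto_const_nhds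
      (tendsto_id.mul_const _) ?_ ?_ hω
    · exact hev.mono fun l' hl' => M.argmaxSel_mem θ (hl2.trans_le hl') ω
    · exact hev.mono fun l' hl' => M.argmaxSel_le hl2 hl' le_rfl ω

lemma tendsto_selectionCost_atTop (M : KernelRegular P B p) (θ : ℝ) :
    Tendsto (selectionCost P B p θ) atTop (𝓝 0) := by
  have hk := M.hk
  have h1 := M.one_sub_pos
  have hb : Tendsto (fun l : ℝ => ((1 + p.k + |θ|) / l) ^ (1 / (1 - p.α)) *
      ∫ ω, kernelZ B p p.τ ω ^ (-(p.α / (1 - p.α))) ∂P) atTop (𝓝 0) := by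
    have h2 : Tendsto (fun l : ℝ => (1 + p.k + |θ|) / l) atTop (𝓝 0) :=
      tendsto_const_nhds.div_atTop tendsto_id
    have h3 := h2.rpow_const (p := 1 / (1 - p.α)) (Or.inr (by positivity))
    rw [Real.zero_rpow (by positivity)] at h3
    simpa using h3.mul_const (∫ ω, kernelZ B p p.τ ω ^ (-(p.α / (1 - p.α))) ∂P)
  refine tendsto_of_tendsto_of_tendsto_of_le_of_le' tendsto_const_nhds hb ?_ ?_
  · filter_upwards [eventually_gt_atTop 0] with l hl
    exact integral_nonneg fun ω =>
      mul_nonneg (kernelZ_pos _ _ _ _).le (M.argmaxSel_mem θ hl ω).1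
  · filter_upwards [eventually_gt_atTop 0] with l hl
    rw [← integral_const_mul]
    refine integral_mono (M.integrable_kernel_mul_argmaxSel θ hl)
      (M.integrable_rpow.const_mul _) fun ω => ?_
    have hz := kernelZ_pos B p p.τ ω
    simp only
    rw [← M.kernel_mul_rpow_kernel]
    calc _ ≤ _ := mul_le_mul_of_nonneg_left (M.argmaxSel_le hl le_rfl le_rfl ω) hz.le
      _ = _ := by ring

lemma exists_selectionCost_eq_one (M : KernelRegular P B p) {θ l : ℝ} (hl : 0 < l)
    (h : 1 ≤ selectionCost P B p θ l) : ∃ l', 0 < l' ∧ selectionCost P B p θ l' = 1 := by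
  obtain ⟨l₁, h1, h2⟩ := ((eventually_ge_atTop l).and
    ((M.tendsto_selectionCost_atTop θ).eventually (gt_mem_nhds one_pos))).exists
  have hc : ContinuousOn (selectionCost P B p θ) (Icc l l₁) := fun x hx =>
    (M.continuousAt_selectionCost θ (hl.trans_le hx.1)).continuousWithinAt
  obtain ⟨l', hl', he⟩ := intermediate_value_Icc' h1 hc ⟨h2.le, h⟩
  exact ⟨l', hl.trans_le hl'.1, he⟩

/-! ### Slack budget constraint -/

lemma integral_kernel_pos (M : KernelRegular P B p) : 0 < ∫ ω, kernelZ B p p.τ ω ∂P := by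
  rw [integral_pos_iff_support_of_nonneg (fun ω => (kernelZ_pos B p p.τ ω).le)
    M.integrable_kernel]
  have : Function.support (kernelZ B p p.τ) = univ := by
    ext ω
    simp [(kernelZ_pos B p p.τ ω).ne']
  rw [this]
  simp

/-- As `l → 0` the prices `l Z` fall below `exp u`, so the selection truncated at `N` is eventually
equal to `N`, while its cost stays below 1. -/
lemma argmaxSel_mul_integral_le (M : KernelRegular P B p) {θ : ℝ}
    (h : ∀ l, 0 < l → selectionCost P B p θ l < 1) (u : ℝ) :
    p.argmaxSel θ (Real.exp u) * ∫ ω, kernelZ B p p.τ ω ∂P ≤ 1 := by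
  set N := p.argmaxSel θ (Real.exp u) with hN
  have hN0 : 0 ≤ N := (Params.argmaxSel_mem M.hα M.hk M.hγ θ (Real.exp_pos u)).1
  have hanti := Params.antitone_argmaxSel_exp M.hα M.hk M.hγ θ
  have hlim : Tendsto (fun l : ℝ => ∫ ω, kernelZ B p p.τ ω *
      min (p.argmaxSel θ (l * kernelZ B p p.τ ω)) N ∂P) (𝓝[>] 0)
      (𝓝 (∫ ω, kernelZ B p p.τ ω * N ∂P)) := by
    refine tendsto_integral_filter_of_dominated_convergence (fun ω => kernelZ B p p.τ ω * N) ?_ ?_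
      (M.integrable_kernel.mul_const N) (ae_of_all _ fun ω => ?_)
    · filter_upwards [self_mem_nhdsWithin] with l hl
      exact (M.measurable.mul
        ((M.measurable_argmaxSel' θ hl).min measurable_const)).aestronglyMeasurable
    · filter_upwards [self_mem_nhdsWithin] with l hl
      refine ae_of_all _ fun ω => ?_
      have hz := kernelZ_pos B p p.τ ω
      rw [Real.norm_of_nonneg (mul_nonneg hz.le (le_min (M.argmaxSel_mem θ hl ω).1 hN0))]
      exact mul_le_mul_of_nonneg_left (min_le_right _ _) hz.le
    · have hz := kernelZ_pos B p p.τ ω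
      refine tendsto_const_nhds.congr' ?_
      filter_upwards [Ioo_mem_nhdsGT (div_pos (Real.exp_pos u) hz)] with l hl
      have hpos := mul_pos hl.1 hz
      have hle : N ≤ p.argmaxSel θ (l * kernelZ B p p.τ ω) := by
        have h1 : Real.log (l * kernelZ B p p.τ ω) ≤ u := by
          rw [Real.log_le_iff_le_exp hpos]
          exact ((lt_div_iff₀ hz).1 hl.2).le
        have := hanti h1
        simpa only [Real.exp_log hpos] using this
      rw [min_eq_right hle]
  rw [integral_mul_const, mul_comm] at hlim
  refine le_of_tendsto hlim ?_
  filter_upwards [self_mem_nhdsWithin] with l hl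
  refine le_trans ?_ (h l hl).le
  refine integral_mono_of_nonneg (ae_of_all _ fun ω => ?_)
    (M.integrable_kernel_mul_argmaxSel θ hl) (ae_of_all _ fun ω => ?_)
  · exact mul_nonneg (kernelZ_pos _ _ _ _).le (le_min (M.argmaxSel_mem θ hl ω).1 hN0)
  · exact mul_le_mul_of_nonneg_left (min_le_left _ _) (kernelZ_pos _ _ _ _).le

/-- By monotonicity and the previous bound the selections converge as the price tends to `0`; the
closed graph makes the limit a maximizer at price `0`. -/
lemma exists_mem_argmaxSet_zero (M : KernelRegular P B p) {θ : ℝ}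
    (h : ∀ l, 0 < l → selectionCost P B p θ l < 1) :
    ∃ y ∈ p.argmaxSet θ 0, y * ∫ ω, kernelZ B p p.τ ω ∂P ≤ 1 := by
  have hI := M.integral_kernel_pos
  have hanti := Params.antitone_argmaxSel_exp M.hα M.hk M.hγ θ
  have hbd : ∀ u, p.argmaxSel θ (Real.exp u) ≤ 1 / ∫ ω, kernelZ B p p.τ ω ∂P := fun u =>
    (le_div_iff₀ hI).2 (M.argmaxSel_mul_integral_le h u)
  have hlim := tendsto_atBot_ciSup hanti ⟨_, by rintro _ ⟨u, rfl⟩; exact hbd u⟩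
  refine ⟨_, Params.mem_argmaxSet_of_tendsto M.hα (tendsto_const_nhds (x := θ))
    Real.tendsto_exp_atBot hlim (Eventually.of_forall fun u =>
      Params.argmaxSel_mem M.hα M.hk M.hγ θ (Real.exp_pos u)), ?_⟩
  rw [← le_div_iff₀ hI]
  exact ciSup_le hbd

lemma mem_optimizers_of_forall_mem (M : KernelRegular P B p) {θ : ℝ} {Y : Ω → ℝ}
    (hY : Y ∈ returns P B p) (h : ∀ ω, Y ω ∈ p.argmaxSet θ 0) :
    Y ∈ optimizers P B p (fun y => p.F y θ) := by
  refine ⟨hY, fun Y' hY' => integral_mono (M.integrable_F_returns hY' θ)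
    (M.integrable_F_returns hY θ) fun ω => ?_⟩
  simpa using (h ω).2 (Y' ω) (hY'.2.1 ω)

end KernelRegular

/-! ### Perturbation at a slack budget constraint. -/

namespace Params

variable {p : Params}

/-- As `y` maximizes `F(·; θ)`, the zeroth-order terms favour `y`; so `w` must do at least as well
in the terms of order `ε`. -/
lemma perturbed_objective_ge {θ σ η z ε y w : ℝ} (hε : 0 < ε) (hy : y ∈ p.argmaxSet θ 0)
    (hw : w ∈ p.argmaxSet (θ + ε * σ) (ε * η * z)) :
    σ * y ^ p.α - η * z * y ≤ σ * w ^ p.α - η * z * w := by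
  have h1 := hw.2 y hy.1
  have h2 := hy.2 w hw.1
  rw [F_add, F_add] at h1
  simp only [zero_mul, sub_zero] at h2
  have : ε * (σ * y ^ p.α - η * z * y) ≤ ε * (σ * w ^ p.α - η * z * w) := by nlinarith
  exact le_of_mul_le_mul_left this hε

/-- If `w ≥ 2y`, then `η z w / 2 ≤ η z (w - y) ≤ w^α + y^α ≤ 2 w^α`, whence the constant 4. -/
lemma le_of_perturbed_objective_ge (hα : p.α ∈ Ioo (0 : ℝ) 1) {σ η z y w : ℝ} (hσ : |σ| ≤ 1)
    (hη : 0 < η) (hz : 0 < z) (hy : 0 ≤ y) (hw : 0 ≤ w)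
    (h : σ * y ^ p.α - η * z * y ≤ σ * w ^ p.α - η * z * w) :
    w ≤ 2 * y + (4 / (η * z)) ^ (1 / (1 - p.α)) := by
  have hnn : 0 ≤ (4 / (η * z)) ^ (1 / (1 - p.α)) := Real.rpow_nonneg (by positivity) _
  rcases le_total w (2 * y) with h2 | h2
  · linarith
  · have hyw := Real.rpow_le_rpow hy (by linarith : y ≤ w) hα.1.le
    have hy0 := Real.rpow_nonneg hy p.α
    have hw0 := Real.rpow_nonneg hw p.α
    have h3 := mul_le_mul_of_nonneg_right (abs_le.1 hσ).2 hw0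
    have h4 := mul_le_mul_of_nonneg_right (abs_le.1 hσ).1 hy0
    have hηz : 0 < η * z := by positivity
    have h5 := mul_le_mul_of_nonneg_left h2 hηz.le
    have := rpow_bound hα hηz (by norm_num : (0 : ℝ) ≤ 4) hw (by linarith)
    linarith

/-- The maximizers `w ε` need not converge, but every limit point lies in `{y₁, y₂}` and is best
there for the first-order objective, so the values converge. -/
lemma tendsto_perturbed_objective (hα : p.α ∈ Ioo (0 : ℝ) 1) {θ σ η z y₁ y₂ : ℝ} (hσ : |σ| ≤ 1)
    (hη : 0 < η) (hz : 0 < z) (h₁ : y₁ ∈ p.argmaxSet θ 0) (h₂ : y₂ ∈ p.argmaxSet θ 0)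
    (hsub : p.argmaxSet θ 0 ⊆ {y₁, y₂}) {w : ℝ → ℝ}
    (hw : ∀ ε, 0 < ε → w ε ∈ p.argmaxSet (θ + ε * σ) (ε * η * z)) :
    Tendsto (fun ε => σ * w ε ^ p.α - η * z * w ε) (𝓝[>] 0)
      (𝓝 (max (σ * y₁ ^ p.α - η * z * y₁) (σ * y₂ ^ p.α - η * z * y₂))) := by
  have hpos : ∀ᶠ ε : ℝ in 𝓝[>] 0, 0 < ε := self_mem_nhdsWithin
  rw [tendsto_iff_ultrafilter]
  intro V hV
  have hVpos : ∀ᶠ ε : ℝ in V, 0 < ε := hV hpos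
  have hmem : ∀ᶠ ε in V, w ε ∈ Icc 0 (2 * y₁ + (4 / (η * z)) ^ (1 / (1 - p.α))) :=
    hVpos.mono fun ε hε => ⟨(hw ε hε).1, le_of_perturbed_objective_ge hα hσ hη hz h₁.1 (hw ε hε).1
      (perturbed_objective_ge hε h₁ (hw ε hε))⟩
  obtain ⟨y, _, hy⟩ := isCompact_Icc.ultrafilter_le_nhds (V.map w)
    (le_principal_iff.2 (show _ ∈ V.map w from hmem))
  have hy' : Tendsto w V (𝓝 y) := hy
  have hid : Tendsto (fun ε : ℝ => ε) V (𝓝 0) := hV.trans nhdsWithin_le_nhds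
  have hyA : y ∈ p.argmaxSet θ 0 := by
    refine mem_argmaxSet_of_tendsto (l := (V : Filter ℝ)) hα (θ := fun ε => θ + ε * σ)
      (x := fun ε => ε * η * z) ?_ ?_ hy' (hVpos.mono fun ε hε => hw ε hε)
    · simpa using (tendsto_const_nhds (x := θ)).add (hid.mul_const σ)
    · simpa using (hid.mul_const η).mul_const z
  have hcont : Continuous fun y : ℝ => σ * y ^ p.α - η * z * y :=
    (continuous_const.mul (continuous_rpow_alpha hα)).sub (continuous_const.mul continuous_id)
  have hlim : Tendsto (fun ε => σ * w ε ^ p.α - η * z * w ε) V (𝓝 (σ * y ^ p.α - η * z * y)) :=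
    (hcont.tendsto y).comp hy'
  have hge : ∀ y' ∈ p.argmaxSet θ 0, σ * y' ^ p.α - η * z * y' ≤ σ * y ^ p.α - η * z * y :=
    fun y' hy' => ge_of_tendsto hlim
      (hVpos.mono fun ε hε => perturbed_objective_ge hε hy' (hw ε hε))
  have heq : max (σ * y₁ ^ p.α - η * z * y₁) (σ * y₂ ^ p.α - η * z * y₂) =
      σ * y ^ p.α - η * z * y := by
    refine le_antisymm (max_le (hge _ h₁) (hge _ h₂)) ?_
    rcases hsub hyA with h | h
    · rw [h]; exact le_max_left _ _
    · rw [mem_singleton_iff.1 h]; exact le_max_right _ _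
  rw [heq]
  exact hlim

end Params

namespace KernelRegular

variable {Ω : Type*} [mΩ : MeasurableSpace Ω] {P : Measure Ω} [IsProbabilityMeasure P]
  {B : ℝ≥0 → Ω → ℝ} {p : Params}

/-- First-order bound on the subgradients of `Φ` at a point where the budget constraint is slack,
obtained from the dual problem by perturbing `θ` and the multiplier `0` simultaneously. -/
lemma subgradient_le_of_slack (M : KernelRegular P B p) {θ σ η y₁ y₂ s : ℝ} (hσ : |σ| ≤ 1)
    (hη : 0 < η) (h₁ : y₁ ∈ p.argmaxSet θ 0) (h₂ : y₂ ∈ p.argmaxSet θ 0)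
    (hsub : p.argmaxSet θ 0 ⊆ {y₁, y₂}) (hΦ : p.F y₁ θ ≤ Phi P B p θ)
    (hs : s ∈ subgradients P B p θ) :
    s * σ ≤ η + ∫ ω, max (σ * y₁ ^ p.α - η * kernelZ B p p.τ ω * y₁)
      (σ * y₂ ^ p.α - η * kernelZ B p p.τ ω * y₂) ∂P := by
  have h1α := M.one_sub_pos
  have hpos : ∀ᶠ ε : ℝ in 𝓝[>] 0, 0 < ε := self_mem_nhdsWithin
  let w : ℝ → Ω → ℝ := fun ε ω => p.argmaxSel (θ + ε * σ) (ε * η * kernelZ B p p.τ ω)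
  have hw : ∀ ω ε, 0 < ε →
      w ε ω ∈ p.argmaxSet (θ + ε * σ) (ε * η * kernelZ B p p.τ ω) := fun ω ε hε =>
    M.argmaxSel_mem _ (mul_pos hε hη) ω
  have hwi : ∀ ε, 0 < ε → Integrable (fun ω => w ε ω ^ p.α) P := fun ε hε =>
    M.integrable_argmaxSel_rpow _ (mul_pos hε hη)
  have hwz : ∀ ε, 0 < ε → Integrable (fun ω => kernelZ B p p.τ ω * w ε ω) P := fun ε hε =>
    M.integrable_kernel_mul_argmaxSel _ (mul_pos hε hη)
  have hint : ∀ ε, 0 < ε →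
      Integrable (fun ω => σ * w ε ω ^ p.α - η * kernelZ B p p.τ ω * w ε ω) P := fun ε hε => by
    have := ((hwi ε hε).const_mul σ).sub ((hwz ε hε).const_mul η)
    refine this.congr (ae_of_all _ fun ω => ?_)
    simp only [Pi.sub_apply]
    ring
  have hval : ∀ ε, 0 < ε → ∫ ω, (σ * w ε ω ^ p.α - η * kernelZ B p p.τ ω * w ε ω) ∂P =
      σ * ∫ ω, w ε ω ^ p.α ∂P - η * ∫ ω, kernelZ B p p.τ ω * w ε ω ∂P := fun ε hε => by
    rw [← integral_const_mul, ← integral_const_mul,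
      ← integral_sub ((hwi ε hε).const_mul σ) ((hwz ε hε).const_mul η)]
    refine integral_congr_ae (ae_of_all _ fun ω => ?_)
    simp only
    ring
  -- Weak duality at `θ + εσ` with multiplier `εη`, compared with the subgradient inequality and
  -- divided by `ε`.
  have hbound : ∀ ε, 0 < ε →
      s * σ ≤ η + ∫ ω, (σ * w ε ω ^ p.α - η * kernelZ B p p.τ ω * w ε ω) ∂P := by
    intro ε hε
    have hd := M.Phi_le_dual (θ + ε * σ) (mul_pos hε hη)
    have ha := M.integral_F_add (M.measurable_argmaxSel' (θ + ε * σ) (mul_pos hε hη))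
      (fun ω => (hw ω ε hε).1) (hwi ε hε) θ (ε * σ)
    have hF : ∫ ω, p.F (w ε ω) θ ∂P ≤ p.F y₁ θ := by
      have := integral_mono (M.integrable_F_argmaxSel (θ + ε * σ) θ (mul_pos hε hη))
        (integrable_const (p.F y₁ θ)) fun ω => by
          simpa using h₁.2 (w ε ω) (hw ω ε hε).1
      simpa using this
    have hsg := hs (θ + ε * σ)
    rw [hval ε hε]
    unfold selectionCost at hd
    have : ε * (s * σ) ≤ ε * (η + (σ * ∫ ω, w ε ω ^ p.α ∂P -
        η * ∫ ω, kernelZ B p p.τ ω * w ε ω ∂P)) := by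
      simp only [w] at hF ha ⊢
      linarith
    exact le_of_mul_le_mul_left this hε
  have hlim : Tendsto (fun ε => ∫ ω, (σ * w ε ω ^ p.α - η * kernelZ B p p.τ ω * w ε ω) ∂P)
      (𝓝[>] 0) (𝓝 (∫ ω, max (σ * y₁ ^ p.α - η * kernelZ B p p.τ ω * y₁)
      (σ * y₂ ^ p.α - η * kernelZ B p p.τ ω * y₂) ∂P)) := by
    refine tendsto_integral_filter_of_dominated_convergence
      (fun ω => ((2 * y₁) ^ p.α + (4 / η) ^ (p.α / (1 - p.α)) *
        kernelZ B p p.τ ω ^ (-(p.α / (1 - p.α)))) + (y₁ ^ p.α + η * kernelZ B p p.τ ω * y₁))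
      ?_ ?_ ?_ ?_
    · filter_upwards [hpos] with ε hε using (hint ε hε).aestronglyMeasurable
    · filter_upwards [hpos] with ε hε
      refine ae_of_all _ fun ω => ?_
      have hz := kernelZ_pos B p p.τ ω
      have hge := Params.perturbed_objective_ge hε h₁ (hw ω ε hε)
      have hw0 := (hw ω ε hε).1
      have hle := Params.le_of_perturbed_objective_ge M.hα hσ hη hz h₁.1 hw0 hge
      have hwa := Real.rpow_nonneg hw0 p.α
      have hya := Real.rpow_nonneg h₁.1 p.α
      have hpow : w ε ω ^ p.α ≤ (2 * y₁) ^ p.α + (4 / η) ^ (p.α / (1 - p.α)) *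
          kernelZ B p p.τ ω ^ (-(p.α / (1 - p.α))) := by
        refine (Real.rpow_le_rpow hw0 hle M.hα.1.le).trans ?_
        refine (Real.rpow_add_le_add_rpow (by linarith [h₁.1]) (Real.rpow_nonneg (by positivity) _)
          M.hα.1.le M.hα.2.le).trans (le_of_eq ?_)
        congr 1
        rw [← Real.rpow_mul (by positivity), ← div_div, Real.div_rpow (by positivity) hz.le,
          Real.rpow_neg hz.le, div_eq_mul_inv]
        congr 2 <;> ring_nf
      have h3 := mul_le_mul_of_nonneg_right (abs_le.1 hσ).2 hwa
      have h4 := mul_le_mul_of_nonneg_right (abs_le.1 hσ).1 hya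
      have h5 : 0 ≤ η * kernelZ B p p.τ ω * w ε ω := by positivity
      have h6 : 0 ≤ η * kernelZ B p p.τ ω * y₁ := mul_nonneg (by positivity) h₁.1
      rw [Real.norm_eq_abs, abs_le]
      constructor <;> linarith
    · refine ((integrable_const _).add (M.integrable_rpow.const_mul _)).add
        ((integrable_const _).add ?_)
      exact (M.integrable_kernel.const_mul η).mul_const y₁
    · exact ae_of_all _ fun ω => Params.tendsto_perturbed_objective M.hα hσ hη
        (kernelZ_pos B p p.τ ω) h₁ h₂ hsub (hw ω)
  refine ge_of_tendsto (hlim.const_add η) ?_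
  filter_upwards [hpos] with ε hε using hbound ε hε

lemma F_le_Phi_of_mem (M : KernelRegular P B p) {θ y : ℝ} (hy : y ∈ p.argmaxSet θ 0)
    (hb : y * ∫ ω, kernelZ B p p.τ ω ∂P ≤ 1) : p.F y θ ≤ Phi P B p θ := by
  simpa using M.le_Phi (M.const_mem_returns hy.1 hb) θ

/-- Take `σ = ±1` and let `η → 0`. -/
lemma eq_of_mem_subgradients_of_slack (M : KernelRegular P B p) {θ y s : ℝ}
    (hy : y ∈ p.argmaxSet θ 0) (hb : y * ∫ ω, kernelZ B p p.τ ω ∂P ≤ 1)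
    (hsub : p.argmaxSet θ 0 ⊆ {y}) (hs : s ∈ subgradients P B p θ) : s = y ^ p.α := by
  have hI := mul_nonneg hy.1 M.integral_kernel_pos.le
  have key : ∀ σ : ℝ, |σ| ≤ 1 → ∀ η : ℝ, 0 < η → s * σ ≤ σ * y ^ p.α + η := by
    intro σ hσ η hη
    have h := M.subgradient_le_of_slack hσ hη hy hy (by simpa using hsub)
      (M.F_le_Phi_of_mem hy hb) hs
    simp only [max_self] at h
    have hi : Integrable (fun ω => η * kernelZ B p p.τ ω * y) P :=
      (M.integrable_kernel.const_mul η).mul_const y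
    have hj : ∫ ω, η * kernelZ B p p.τ ω * y ∂P = η * (∫ ω, kernelZ B p p.τ ω ∂P) * y := by
      rw [integral_mul_const, integral_const_mul]
    rw [integral_sub (integrable_const _) hi, hj] at h
    simp only [integral_const, probReal_univ, smul_eq_mul, one_mul] at h
    nlinarith
  refine le_antisymm (le_of_forall_pos_le_add fun η hη => ?_)
    (le_of_forall_pos_le_add fun η hη => ?_)
  · simpa using key 1 (by simp) η hη
  · have := key (-1) (by simp) η hη
    linarith

/-! ### Two maximizers -/

lemma measurableSet_kernel_le (M : KernelRegular P B p) (c : ℝ) :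
    MeasurableSet {ω | kernelZ B p p.τ ω ≤ c} :=
  M.measurable measurableSet_Iic

lemma continuous_measureReal_kernel_le (M : KernelRegular P B p) :
    Continuous fun c : ℝ => P.real {ω | kernelZ B p p.τ ω ≤ c} := by
  have heq : (fun c : ℝ => P.real {ω | kernelZ B p p.τ ω ≤ c}) =
      fun c => ∫ ω, {ω | kernelZ B p p.τ ω ≤ c}.indicator (fun _ => (1 : ℝ)) ω ∂P := by
    funext c
    rw [integral_indicator_const _ (M.measurableSet_kernel_le c)]
    simp
  rw [heq, continuous_iff_continuousAt]
  intro c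
  refine tendsto_integral_filter_of_dominated_convergence (fun _ => (1 : ℝ)) ?_ ?_
    (integrable_const _) ?_
  · exact Eventually.of_forall fun c' =>
      (measurable_const.indicator (M.measurableSet_kernel_le c')).aestronglyMeasurable
  · refine Eventually.of_forall fun c' => ae_of_all _ fun ω => ?_
    by_cases h : kernelZ B p p.τ ω ≤ c' <;> simp [indicator, h]
  · have hne : ∀ᵐ ω ∂P, kernelZ B p p.τ ω ≠ c := by
      rw [ae_iff]
      simpa using M.measure_kernel_eq c
    filter_upwards [hne] with ω hω
    refine tendsto_const_nhds.congr' ?_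
    rcases hω.lt_or_gt with h | h
    · filter_upwards [lt_mem_nhds h] with c' hc'
      simp [indicator, h.le, hc'.le]
    · filter_upwards [gt_mem_nhds h] with c' hc'
      simp [indicator, not_le.2 h, not_le.2 hc']

/-- The value of `η` makes `y^α - η Z y` change sign exactly at `Z = c`, so the maximum with `0`
becomes a truncation to `{Z ≤ c}`. -/
lemma subgradient_le_truncated (M : KernelRegular P B p) {θ y s c : ℝ} (hc : 0 < c)
    (hy : y ∈ p.argmaxSet θ 0) (hpos : 0 < y) (h0 : (0 : ℝ) ∈ p.argmaxSet θ 0)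
    (hs : s ∈ subgradients P B p θ) :
    s ≤ y ^ p.α * P.real {ω | kernelZ B p p.τ ω ≤ c} + y ^ p.α / (y * c) *
      (1 - y * ∫ ω in {ω | kernelZ B p p.τ ω ≤ c}, kernelZ B p p.τ ω ∂P) := by
  have hya : 0 < y ^ p.α := Real.rpow_pos_of_pos hpos _
  have hsub : p.argmaxSet θ 0 ⊆ {0, y} :=
    Params.argmaxSet_zero_subset_pair M.hα M.hk M.hγ hy hpos
  have h := M.subgradient_le_of_slack (σ := 1) (η := y ^ p.α / (y * c)) (by simp) (by positivity)
    h0 hy hsub (M.F_le_Phi_of_mem h0 (by simp)) hs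
  have hfun : (fun ω => max (1 * (0 : ℝ) ^ p.α - y ^ p.α / (y * c) * kernelZ B p p.τ ω * 0)
      (1 * y ^ p.α - y ^ p.α / (y * c) * kernelZ B p p.τ ω * y)) =
      {ω | kernelZ B p p.τ ω ≤ c}.indicator
        (fun ω => y ^ p.α - y ^ p.α / c * kernelZ B p p.τ ω) := by
    funext ω
    rw [Real.zero_rpow M.hα.1.ne', mul_zero, mul_zero, sub_zero, one_mul]
    have e : y ^ p.α - y ^ p.α / (y * c) * kernelZ B p p.τ ω * y =
        y ^ p.α / c * (c - kernelZ B p p.τ ω) := by field_simp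
    have e' : y ^ p.α - y ^ p.α / c * kernelZ B p p.τ ω =
        y ^ p.α / c * (c - kernelZ B p p.τ ω) := by field_simp
    rw [e]
    by_cases hω : kernelZ B p p.τ ω ≤ c
    · rw [indicator_of_mem (show ω ∈ {ω | kernelZ B p p.τ ω ≤ c} from hω), e']
      exact max_eq_right (mul_nonneg (by positivity) (by linarith))
    · rw [indicator_of_notMem (show ω ∉ {ω | kernelZ B p p.τ ω ≤ c} from hω)]
      refine max_eq_left ?_
      have : 0 < y ^ p.α / c := by positivity
      nlinarith [not_le.1 hω]
  rw [hfun, integral_indicator (M.measurableSet_kernel_le c),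
    integral_sub (integrable_const _) (M.integrable_kernel.integrableOn.const_mul _),
    integral_const_mul, setIntegral_const, smul_eq_mul] at h
  refine (mul_one s).symm.le.trans (h.trans (le_of_eq ?_))
  field_simp
  ring

lemma indicator_kernel_mem_returns (M : KernelRegular P B p) {y c : ℝ} (hy : 0 ≤ y)
    (h : y * ∫ ω in {ω | kernelZ B p p.τ ω ≤ c}, kernelZ B p p.τ ω ∂P ≤ 1) :
    {ω | kernelZ B p p.τ ω ≤ c}.indicator (fun _ => y) ∈ returns P B p := by
  have heq : (fun ω => kernelZ B p p.τ ω * {ω | kernelZ B p p.τ ω ≤ c}.indicator (fun _ => y) ω) =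
      {ω | kernelZ B p p.τ ω ≤ c}.indicator (fun ω => kernelZ B p p.τ ω * y) := by
    funext ω
    by_cases hω : kernelZ B p p.τ ω ≤ c <;> simp [indicator, hω]
  refine ⟨Measurable.indicator measurable_const (M.measurable_kernel measurableSet_Iic),
    fun ω => indicator_nonneg (fun _ _ => hy) ω, ?_, ?_⟩
  · rw [heq]
    exact (M.integrable_kernel.mul_const y).indicator (M.measurableSet_kernel_le c)
  · rw [heq, integral_indicator (M.measurableSet_kernel_le c), integral_mul_const, mul_comm]
    exact h

/-- Returns with values in `{0, y}` are pointwise optimal, so only the budget matters. If `s < y^α`,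
choose `c` with `y^α P(Z ≤ c) = s`; the truncated bound then shows that `y 1_{Z ≤ c}` is affordable.
If `s ≥ y^α`, all truncations are affordable, hence so is the constant `y`, and `s = y^α`. -/
lemma mem_optimalMoments_of_two_maximizers (M : KernelRegular P B p) {θ y s : ℝ}
    (hy : y ∈ p.argmaxSet θ 0) (hpos : 0 < y) (h0 : (0 : ℝ) ∈ p.argmaxSet θ 0)
    (hs : s ∈ subgradients P B p θ) :
    s ∈ optimalMoments P B p (fun y => p.F y θ) := by
  have hya : 0 < y ^ p.α := Real.rpow_pos_of_pos hpos _
  have hs0 := (M.subgradients_subset_Icc θ hs).1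
  have hbudget : ∀ c : ℝ, 0 < c → y ^ p.α * P.real {ω | kernelZ B p p.τ ω ≤ c} ≤ s →
      y * ∫ ω in {ω | kernelZ B p p.τ ω ≤ c}, kernelZ B p p.τ ω ∂P ≤ 1 := by
    intro c hc hle
    have h := M.subgradient_le_truncated hc hy hpos h0 hs
    have h2 : 0 ≤ y ^ p.α / (y * c) *
        (1 - y * ∫ ω in {ω | kernelZ B p p.τ ω ≤ c}, kernelZ B p p.τ ω ∂P) := by linarith
    have h3 := nonneg_of_mul_nonneg_right h2 (by positivity)
    linarith
  rcases lt_or_ge s (y ^ p.α) with hlt | hge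
  · have hzero : P.real {ω | kernelZ B p p.τ ω ≤ 0} = 0 := by
      have : {ω | kernelZ B p p.τ ω ≤ 0} = ∅ := by
        ext ω
        simpa using kernelZ_pos B p p.τ ω
      rw [this]
      simp
    have hone : Tendsto (fun c : ℝ => P.real {ω | kernelZ B p p.τ ω ≤ c}) atTop (𝓝 1) := by
      have hm : Monotone fun c : ℝ => {ω | kernelZ B p p.τ ω ≤ c} := fun a b hab ω hω =>
        le_trans (show kernelZ B p p.τ ω ≤ a from hω) hab
      have hU : ⋃ c : ℝ, {ω | kernelZ B p p.τ ω ≤ c} = univ :=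
        eq_univ_of_forall fun ω => mem_iUnion.2 ⟨kernelZ B p p.τ ω, le_refl (kernelZ B p p.τ ω)⟩
      have := tendsto_measure_iUnion_atTop (μ := P) hm
      rw [hU, measure_univ] at this
      simpa [Measure.real, Function.comp_def] using (ENNReal.tendsto_toReal ENNReal.one_ne_top).comp this
    obtain ⟨c₁, hc₁, hc₁'⟩ := ((eventually_ge_atTop 0).and
      (hone.eventually (lt_mem_nhds ((div_lt_one hya).2 hlt)))).exists
    obtain ⟨c, hc, hceq⟩ := intermediate_value_Icc hc₁
      M.continuous_measureReal_kernel_le.continuousOn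
      (show s / y ^ p.α ∈ Icc _ _ from ⟨by rw [hzero]; positivity, hc₁'.le⟩)
    have hval : y ^ p.α * P.real {ω | kernelZ B p p.τ ω ≤ c} = s := by
      simp only at hceq
      rw [hceq]
      field_simp
    have hbud : y * ∫ ω in {ω | kernelZ B p p.τ ω ≤ c}, kernelZ B p p.τ ω ∂P ≤ 1 := by
      rcases hc.1.eq_or_lt with hc0 | hc0
      · rw [← hc0, setIntegral_measure_zero]
        · simp
        · exact (measureReal_eq_zero_iff (by finiteness)).1 hzero
      · exact hbudget c hc0 hval.le
    have hmem := M.indicator_kernel_mem_returns hpos.le hbud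
    refine ⟨_, M.mem_optimizers_of_forall_mem hmem fun ω => ?_, ?_⟩
    · by_cases hω : kernelZ B p p.τ ω ≤ c
      · rwa [indicator_of_mem (show ω ∈ {ω | kernelZ B p p.τ ω ≤ c} from hω)]
      · rwa [indicator_of_notMem (show ω ∉ {ω | kernelZ B p p.τ ω ≤ c} from hω)]
    · have : (fun ω => {ω | kernelZ B p p.τ ω ≤ c}.indicator (fun _ => y) ω ^ p.α) =
          {ω | kernelZ B p p.τ ω ≤ c}.indicator (fun _ => y ^ p.α) := by
        funext ω
        by_cases hω : kernelZ B p p.τ ω ≤ c <;>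
          simp [indicator, hω, Real.zero_rpow M.hα.1.ne']
      simp only
      rw [this, integral_indicator_const _ (M.measurableSet_kernel_le c), smul_eq_mul, mul_comm]
      exact hval
  -- The shift by 1 keeps the threshold positive at `n = 0`.
  · have hall : ∀ n : ℕ,
        y * ∫ ω in {ω | kernelZ B p p.τ ω ≤ (n : ℝ) + 1}, kernelZ B p p.τ ω ∂P ≤ 1 := by
      intro n
      refine hbudget _ (by positivity) (le_trans ?_ hge)
      have : P.real {ω | kernelZ B p p.τ ω ≤ (n : ℝ) + 1} ≤ 1 := measureReal_le_one
      nlinarith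
    have hlim := tendsto_setIntegral_of_monotone (μ := P) (f := kernelZ B p p.τ)
      (s := fun n : ℕ => {ω | kernelZ B p p.τ ω ≤ (n : ℝ) + 1})
      (fun n => M.measurableSet_kernel_le _)
      (fun a b hab ω hω => le_trans (show kernelZ B p p.τ ω ≤ (a : ℝ) + 1 from hω)
        (by have : (a : ℝ) ≤ b := by exact_mod_cast hab
            linarith)) M.integrable_kernel.integrableOn
    have hU : ⋃ n : ℕ, {ω | kernelZ B p p.τ ω ≤ (n : ℝ) + 1} = univ := by
      refine eq_univ_of_forall fun ω => mem_iUnion.2 ?_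
      obtain ⟨n, hn⟩ := exists_nat_ge (kernelZ B p p.τ ω)
      exact ⟨n, show kernelZ B p p.τ ω ≤ (n : ℝ) + 1 by linarith⟩
    rw [hU, setIntegral_univ] at hlim
    have hbud : y * ∫ ω, kernelZ B p p.τ ω ∂P ≤ 1 :=
      le_of_tendsto (hlim.const_mul y) (Eventually.of_forall hall)
    have hmem := M.const_mem_returns hpos.le hbud
    have hopt := M.mem_optimizers_of_forall_mem hmem fun _ => hy
    have hle : s ≤ y ^ p.α := by
      refine le_of_forall_pos_le_add fun η hη => ?_
      have h := M.subgradient_le_of_slack (σ := 1) (by simp) hη h0 hy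
        (Params.argmaxSet_zero_subset_pair M.hα M.hk M.hγ hy hpos)
        (M.F_le_Phi_of_mem h0 (by simp)) hs
      have hmono : ∫ ω, max (1 * (0 : ℝ) ^ p.α - η * kernelZ B p p.τ ω * 0)
          (1 * y ^ p.α - η * kernelZ B p p.τ ω * y) ∂P ≤ ∫ _, y ^ p.α ∂P := by
        refine integral_mono_of_nonneg (ae_of_all _ fun ω => ?_) (integrable_const _)
          (ae_of_all _ fun ω => ?_)
        · refine le_max_of_le_left ?_
          simp [Real.zero_rpow M.hα.1.ne']
        · refine max_le ?_ ?_
          · simp only [Real.zero_rpow M.hα.1.ne', mul_zero, sub_zero]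
            exact hya.le
          · have := mul_pos (mul_pos hη (kernelZ_pos B p p.τ ω)) hpos
            linarith
      simp only [integral_const, probReal_univ, smul_eq_mul, one_mul] at hmono
      simp only [one_mul] at h
      linarith
    exact ⟨_, hopt, by simpa using le_antisymm hge hle⟩

/-! ### The optimal moments are the subgradients of `Φ` -/

/-- Either the optimal moment is the unique subgradient, or the budget constraint is slack and
`F(·; θ)` has exactly two maximizers. -/
lemma exists_unique_moment_or_two_maximizers (M : KernelRegular P B p) (θ : ℝ) :
    (∃ m ∈ optimalMoments P B p (fun y => p.F y θ), ∀ s ∈ subgradients P B p θ, s = m) ∨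
      (0 : ℝ) ∈ p.argmaxSet θ 0 ∧ ∃ y ∈ p.argmaxSet θ 0, 0 < y := by
  -- Binding versus slack budget: by continuity and decay of the cost, a cost of at least 1
  -- somewhere yields a multiplier of cost exactly 1.
  by_cases hcost : ∃ l, 0 < l ∧ 1 ≤ selectionCost P B p θ l
  · obtain ⟨l₀, hl₀, h₀⟩ := hcost
    obtain ⟨l, hl, h⟩ := M.exists_selectionCost_eq_one hl₀ h₀
    exact Or.inl ⟨_, ⟨_, M.argmaxSel_mem_optimizers hl h, rfl⟩,
      fun s hs => M.eq_of_mem_subgradients_of_selectionCost hl h hs⟩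
  · push Not at hcost
    obtain ⟨y, hy, hb⟩ := M.exists_mem_argmaxSet_zero hcost
    by_cases hsub : p.argmaxSet θ 0 ⊆ {y}
    · refine Or.inl ⟨y ^ p.α, ⟨_, M.mem_optimizers_of_forall_mem
        (M.const_mem_returns hy.1 hb) fun _ => hy, by simp⟩,
        fun s hs => M.eq_of_mem_subgradients_of_slack hy hb hsub hs⟩
    · obtain ⟨w, hw, hne⟩ := not_subset.1 hsub
      right
      rcases hy.1.eq_or_lt with h | h
      · refine ⟨h ▸ hy, w, hw, lt_of_le_of_ne hw.1 fun h' => hne ?_⟩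
        exact h'.symm.trans h
      · rcases Params.argmaxSet_zero_subset_pair M.hα M.hk M.hγ hy h hw with h' | h'
        · exact ⟨h' ▸ hw, y, hy, h⟩
        · exact absurd h' hne

theorem optimalMoments_eq_subgradients (M : KernelRegular P B p) (θ : ℝ) :
    optimalMoments P B p (fun y => p.F y θ) = subgradients P B p θ := by
  refine Subset.antisymm (M.optimalMoments_subset_subgradients θ) fun s hs => ?_
  rcases M.exists_unique_moment_or_two_maximizers θ with ⟨m, hm, hu⟩ | ⟨h0, y, hy, hpos⟩
  · rwa [hu s hs]
  · exact M.mem_optimalMoments_of_two_maximizers hy hpos h0 hs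

theorem subgradients_nonempty (M : KernelRegular P B p) (θ : ℝ) :
    (subgradients P B p θ).Nonempty := by
  rcases M.exists_unique_moment_or_two_maximizers θ with ⟨m, hm, _⟩ | ⟨h0, _⟩
  · exact ⟨m, M.optimalMoments_subset_subgradients θ hm⟩
  · exact ⟨_, M.optimalMoments_subset_subgradients θ ⟨_, M.mem_optimizers_of_forall_mem
      (M.const_mem_returns le_rfl (by simp)) fun _ => h0, rfl⟩⟩

theorem subgradients_subsingleton (M : KernelRegular P B p) {θ : ℝ} (hθ : θ ≠ p.thetaLow) :
    (subgradients P B p θ).Subsingleton := by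
  rcases M.exists_unique_moment_or_two_maximizers θ with ⟨m, _, hu⟩ | ⟨h0, y, hy, hpos⟩
  · intro s hs s' hs'
    rw [hu s hs, hu s' hs']
  · exact absurd (Params.eq_thetaLow_of_mem_argmaxSet M.hα M.hk M.hγ h0 hy hpos) hθ

end KernelRegular

/-! ### Fixed points of a subdifferential along a curve. -/

/-- A set-valued map `ξ ↦ ∂f (t ξ)`, with `f` and `t` continuous and `∂f` nonempty with values in
`[0, e]`, has a fixed point in `[0, e]`. -/
lemma exists_mem_subdifferential {f t : ℝ → ℝ} {e : ℝ} (he : 0 ≤ e) (hf : Continuous f)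
    (ht : ContinuousOn t (Icc 0 e))
    (hne : ∀ θ, ∃ s, ∀ θ', f θ + s * (θ' - θ) ≤ f θ')
    (hsub : ∀ θ s, (∀ θ', f θ + s * (θ' - θ) ≤ f θ') → s ∈ Icc 0 e) :
    ∃ ξ ∈ Icc 0 e, ∀ θ', f (t ξ) + ξ * (θ' - t ξ) ≤ f θ' := by
  set t' : ℝ → ℝ := IccExtend he ((Icc 0 e).domRestrict t) with ht'
  have htc : Continuous t' := (continuousOn_iff_continuous_domRestrict.1 ht).Icc_extend'
  have hgraph : IsClosed {q : ℝ × ℝ | ∀ θ', f (t' q.1) + q.2 * (θ' - t' q.1) ≤ f θ'} := by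
    have : {q : ℝ × ℝ | ∀ θ', f (t' q.1) + q.2 * (θ' - t' q.1) ≤ f θ'} =
        ⋂ θ', {q : ℝ × ℝ | f (t' q.1) + q.2 * (θ' - t' q.1) ≤ f θ'} := by
      ext q; simp
    rw [this]
    exact isClosed_iInter fun θ' => isClosed_le (by fun_prop) continuous_const
  have hcompact : IsCompact (Icc (0 : ℝ) e ×ˢ Icc (0 : ℝ) e) := isCompact_Icc.prod isCompact_Icc
  -- `T₁` and `T₂` collect the `ξ` having a subgradient above, respectively below, `ξ`. They are
  -- projections of compact sets and cover the interval, so connectedness makes them meet.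
  set T₁ : Set ℝ := Prod.fst '' ((Icc (0 : ℝ) e ×ˢ Icc (0 : ℝ) e) ∩
    ({q : ℝ × ℝ | ∀ θ', f (t' q.1) + q.2 * (θ' - t' q.1) ≤ f θ'} ∩ {q | q.1 ≤ q.2})) with hT₁
  set T₂ : Set ℝ := Prod.fst '' ((Icc (0 : ℝ) e ×ˢ Icc (0 : ℝ) e) ∩
    ({q : ℝ × ℝ | ∀ θ', f (t' q.1) + q.2 * (θ' - t' q.1) ≤ f θ'} ∩ {q | q.2 ≤ q.1})) with hT₂
  have hc₁ : IsClosed T₁ := ((hcompact.inter_right (hgraph.inter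
    (isClosed_le continuous_fst continuous_snd))).image continuous_fst).isClosed
  have hc₂ : IsClosed T₂ := ((hcompact.inter_right (hgraph.inter
    (isClosed_le continuous_snd continuous_fst))).image continuous_fst).isClosed
  have hmem : ∀ ξ ∈ Icc 0 e, ∃ m ∈ Icc 0 e, ∀ θ', f (t' ξ) + m * (θ' - t' ξ) ≤ f θ' := by
    intro ξ _
    obtain ⟨m, hm⟩ := hne (t' ξ)
    exact ⟨m, hsub _ _ hm, hm⟩
  have h0 : (0 : ℝ) ∈ Icc 0 e := left_mem_Icc.2 he
  have h1 : e ∈ Icc 0 e := right_mem_Icc.2 he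
  obtain ⟨ξ, hξ, ⟨⟨ξ₁, m₁⟩, ⟨_, hm₁, hle₁⟩, hξ₁⟩, ⟨⟨ξ₂, m₂⟩, ⟨_, hm₂, hle₂⟩, hξ₂⟩⟩ :=
    isPreconnected_closed_iff.1 (isPreconnected_Icc (a := (0 : ℝ)) (b := e)) T₁ T₂ hc₁ hc₂
    (by
      intro ξ hξ
      obtain ⟨m, hmI, hm⟩ := hmem ξ hξ
      rcases le_total ξ m with h | h
      · exact Or.inl ⟨(ξ, m), ⟨⟨hξ, hmI⟩, hm, h⟩, rfl⟩
      · exact Or.inr ⟨(ξ, m), ⟨⟨hξ, hmI⟩, hm, h⟩, rfl⟩)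
    (by
      obtain ⟨m, hmI, hm⟩ := hmem 0 h0
      exact ⟨0, h0, (0, m), ⟨⟨h0, hmI⟩, hm, hmI.1⟩, rfl⟩)
    (by
      obtain ⟨m, hmI, hm⟩ := hmem e h1
      exact ⟨e, h1, (e, m), ⟨⟨h1, hmI⟩, hm, hmI.2⟩, rfl⟩)
  simp only at hξ₁ hξ₂
  subst hξ₁ hξ₂
  have htξ : t' ξ₂ = t ξ₂ := by rw [ht', IccExtend_of_mem he _ hξ]; rfl
  refine ⟨ξ₂, hξ, fun θ' => ?_⟩
  have a₁ := hm₁ θ'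
  have a₂ := hm₂ θ'
  simp only [mem_ofPred_eq, htξ] at a₁ a₂ hle₁ hle₂
  -- Convexity of the subdifferential: `m₁ ≥ ξ` serves to the right of `t ξ` and `m₂ ≤ ξ` to the
  -- left.
  rcases le_total (t ξ₂) θ' with h | h
  · have := mul_le_mul_of_nonneg_right hle₁ (sub_nonneg.2 h)
    linarith
  · have := mul_le_mul_of_nonpos_right hle₂ (sub_nonpos.2 h)
    linarith

/-! ### The weight `κ`, the fixed points `θ*` and the map `G`. -/

namespace Params

variable {p : Params}

lemma thetaLow_neg (hk : 0 ≤ p.k) : p.thetaLow < 0 := by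
  have := Real.rpow_nonneg hk (1 / (1 - p.α))
  exact neg_neg_of_pos (Real.rpow_pos_of_pos (by linarith) _)

lemma disc_pos (p : Params) : 0 < p.disc := Real.exp_pos _

/-- The contraction constant for `θ*`; it also keeps the denominator of `κ` positive. -/
lemma disc_mul_exp_lt_one (hτ : 0 < p.τ) (h : p.h < p.δ) :
    p.disc * Real.exp (p.h * p.τ) < 1 := by
  rw [disc, ← Real.exp_add, Real.exp_lt_one_iff]
  have : (0 : ℝ) < p.τ := hτ
  nlinarith

lemma kappa_denom_ge (hβ : p.β ∈ Icc (0 : ℝ) 1) (hτ : 0 < p.τ) (h : p.h < p.δ) {ξ : ℝ}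
    (hξ : ξ ∈ Icc 0 (Real.exp (p.h * p.τ))) :
    0 < 1 - (1 - p.β) * p.disc * ξ ∧ p.β ≤ 1 - (1 - p.β) * p.disc * ξ := by
  have h1 := disc_mul_exp_lt_one hτ h
  have h2 : p.disc * ξ < 1 := lt_of_le_of_lt (mul_le_mul_of_nonneg_left hξ.2 p.disc_pos.le) h1
  have h3 : 0 ≤ p.disc * ξ := mul_nonneg p.disc_pos.le hξ.1
  have h4 : (1 - p.β) * (p.disc * ξ) ≤ 1 * (p.disc * ξ) :=
    mul_le_mul_of_nonneg_right (by linarith [hβ.1]) h3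
  have h5 : (1 - p.β) * (p.disc * ξ) ≤ (1 - p.β) * 1 :=
    mul_le_mul_of_nonneg_left h2.le (by linarith [hβ.2])
  rw [mul_assoc]
  constructor <;> linarith

lemma kappa_mem_Icc (hβ : p.β ∈ Icc (0 : ℝ) 1) (hτ : 0 < p.τ) (h : p.h < p.δ) {ξ : ℝ}
    (hξ : ξ ∈ Icc 0 (Real.exp (p.h * p.τ))) : p.kappa ξ ∈ Icc (0 : ℝ) 1 := by
  obtain ⟨h1, h2⟩ := kappa_denom_ge hβ hτ h hξ
  exact ⟨div_nonneg hβ.1 h1.le, (div_le_one h1).2 h2⟩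

lemma continuousOn_kappa (hβ : p.β ∈ Icc (0 : ℝ) 1) (hτ : 0 < p.τ) (h : p.h < p.δ) :
    ContinuousOn p.kappa (Icc 0 (Real.exp (p.h * p.τ))) :=
  continuousOn_const.div (by fun_prop) fun _ hξ => (kappa_denom_ge hβ hτ h hξ).1.ne'

lemma kappa_lt_kappa (hβ : p.β ∈ Ioo (0 : ℝ) 1) (hτ : 0 < p.τ) (h : p.h < p.δ) {ξ ξ' : ℝ}
    (hξ' : ξ' ∈ Icc 0 (Real.exp (p.h * p.τ))) (hlt : ξ < ξ') : p.kappa ξ < p.kappa ξ' := by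
  refine div_lt_div_of_pos_left hβ.1 (kappa_denom_ge ⟨hβ.1.le, hβ.2.le⟩ hτ h hξ').1 ?_
  have : 0 < (1 - p.β) * p.disc := mul_pos (by linarith [hβ.2]) p.disc_pos
  nlinarith

end Params

namespace KernelRegular

variable {Ω : Type*} [mΩ : MeasurableSpace Ω] {P : Measure Ω} [IsProbabilityMeasure P]
  {B : ℝ≥0 → Ω → ℝ} {p : Params}

lemma disc_mul_Phi_sub_le (M : KernelRegular P B p) (θ θ' : ℝ) :
    |p.disc * Phi P B p θ - p.disc * Phi P B p θ'| ≤
      p.disc * Real.exp (p.h * p.τ) * |θ - θ'| := by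
  rw [← mul_sub, abs_mul, abs_of_pos p.disc_pos, mul_assoc]
  exact mul_le_mul_of_nonneg_left (M.abs_Phi_sub_le θ θ') p.disc_pos.le

lemma exists_fixedPoint (M : KernelRegular P B p) (hde : p.disc * Real.exp (p.h * p.τ) < 1) {κ : ℝ}
    (hκ : κ ∈ Icc (0 : ℝ) 1) : ∃ θ, θ = p.disc * Phi P B p (κ * θ) := by
  have hpos : 0 ≤ p.disc * Real.exp (p.h * p.τ) := mul_nonneg p.disc_pos.le (Real.exp_pos _).le
  have hc : ContractingWith ⟨p.disc * Real.exp (p.h * p.τ), hpos⟩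
      fun θ => p.disc * Phi P B p (κ * θ) := by
    refine ⟨by exact_mod_cast hde, LipschitzWith.of_dist_le_mul fun x y => ?_⟩
    refine (M.disc_mul_Phi_sub_le (κ * x) (κ * y)).trans ?_
    refine mul_le_mul_of_nonneg_left ?_ hpos
    rw [← mul_sub, abs_mul, abs_of_nonneg hκ.1, Real.dist_eq]
    exact mul_le_of_le_one_left (abs_nonneg _) hκ.2
  exact ⟨_, hc.fixedPoint_isFixedPt.symm⟩

lemma thetaStar_eq (M : KernelRegular P B p) (hde : p.disc * Real.exp (p.h * p.τ) < 1) {κ : ℝ}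
    (hκ : κ ∈ Icc (0 : ℝ) 1) :
    thetaStar P B p κ = p.disc * Phi P B p (κ * thetaStar P B p κ) :=
  Classical.epsilon_spec (M.exists_fixedPoint hde hκ)

/-- Stability of the fixed points with respect to `κ`. -/
lemma abs_sub_le_of_fixedPoint (M : KernelRegular P B p) {κ κ' θ θ' : ℝ}
    (hκ : κ ∈ Icc (0 : ℝ) 1)
    (hθ : θ = p.disc * Phi P B p (κ * θ)) (hθ' : θ' = p.disc * Phi P B p (κ' * θ')) :
    (1 - p.disc * Real.exp (p.h * p.τ)) * |θ - θ'| ≤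
      p.disc * Real.exp (p.h * p.τ) * (|κ - κ'| * |θ'|) := by
  have hpos : 0 ≤ p.disc * Real.exp (p.h * p.τ) := mul_nonneg p.disc_pos.le (Real.exp_pos _).le
  have h1 := M.disc_mul_Phi_sub_le (κ * θ) (κ' * θ')
  rw [← hθ, ← hθ'] at h1
  have h2 : |κ * θ - κ' * θ'| ≤ |θ - θ'| + |κ - κ'| * |θ'| := by
    have : κ * θ - κ' * θ' = κ * (θ - θ') + (κ - κ') * θ' := by ring
    rw [this]
    refine (abs_add_le _ _).trans ?_
    rw [abs_mul, abs_mul, abs_of_nonneg hκ.1]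
    have := mul_le_of_le_one_left (abs_nonneg (θ - θ')) hκ.2
    linarith
  have h3 := mul_le_mul_of_nonneg_left h2 hpos
  linarith

lemma eq_thetaStar_iff (M : KernelRegular P B p) (hde : p.disc * Real.exp (p.h * p.τ) < 1) {κ : ℝ}
    (hκ : κ ∈ Icc (0 : ℝ) 1) (θ : ℝ) :
    θ = p.disc * Phi P B p (κ * θ) ↔ θ = thetaStar P B p κ := by
  constructor
  · intro h
    have h1 := M.abs_sub_le_of_fixedPoint hκ h (M.thetaStar_eq hde hκ)
    simp only [sub_self, abs_zero, zero_mul, mul_zero] at h1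
    have h2 : |θ - thetaStar P B p κ| ≤ 0 := by
      by_contra! hlt
      nlinarith
    exact sub_eq_zero.1 (abs_nonpos_iff.1 h2)
  · rintro rfl
    exact M.thetaStar_eq hde hκ

lemma continuousOn_thetaStar (M : KernelRegular P B p)
    (hde : p.disc * Real.exp (p.h * p.τ) < 1) :
    ContinuousOn (thetaStar P B p) (Icc 0 1) := by
  intro κ₀ hκ₀
  rw [ContinuousWithinAt, tendsto_iff_dist_tendsto_zero]
  set d := p.disc * Real.exp (p.h * p.τ) with hd
  have hlim : Tendsto (fun κ : ℝ => d * (|κ - κ₀| * |thetaStar P B p κ₀|) / (1 - d))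
      (𝓝[Icc 0 1] κ₀) (𝓝 0) := by
    have : Continuous fun κ : ℝ => d * (|κ - κ₀| * |thetaStar P B p κ₀|) / (1 - d) := by fun_prop
    simpa using (this.tendsto κ₀).mono_left nhdsWithin_le_nhds
  refine squeeze_zero' (Eventually.of_forall fun _ => dist_nonneg) ?_ hlim
  filter_upwards [self_mem_nhdsWithin] with κ hκ
  rw [le_div_iff₀ (by linarith), mul_comm, Real.dist_eq]
  exact M.abs_sub_le_of_fixedPoint hκ (M.thetaStar_eq hde hκ) (M.thetaStar_eq hde hκ₀)

lemma G_eq_subgradients (M : KernelRegular P B p) (ξ : ℝ) :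
    G P B p ξ = subgradients P B p (p.kappa ξ * thetaStar P B p (p.kappa ξ)) :=
  M.optimalMoments_eq_subgradients _

lemma exists_mem_G (M : KernelRegular P B p) (hτ : 0 < p.τ) (hβ : p.β ∈ Icc (0 : ℝ) 1)
    (hδh : p.h < p.δ) : ∃ ξ ∈ Icc (0 : ℝ) (Real.exp (p.h * p.τ)), ξ ∈ G P B p ξ := by
  have hκ := Params.continuousOn_kappa hβ hτ hδh
  have ht : ContinuousOn (fun ξ => p.kappa ξ * thetaStar P B p (p.kappa ξ))
      (Icc 0 (Real.exp (p.h * p.τ))) :=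
    hκ.mul ((M.continuousOn_thetaStar (Params.disc_mul_exp_lt_one hτ hδh)).comp hκ
      fun ξ hξ => Params.kappa_mem_Icc hβ hτ hδh hξ)
  obtain ⟨ξ, hξ, h⟩ := exists_mem_subdifferential (Real.exp_pos _).le M.continuous_Phi ht
    M.subgradients_nonempty fun θ s hs => M.subgradients_subset_Icc θ hs
  exact ⟨ξ, hξ, by rw [M.G_eq_subgradients]; exact h⟩

/-- If `θ*(κ) ≥ 0`, the Lipschitz bound gives `θ*(κ) ≤ θ*(0) + d θ*(κ)` with `d < 1`, impossible
when `θ*(0) < 0`. -/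
lemma thetaStar_neg (M : KernelRegular P B p) (hde : p.disc * Real.exp (p.h * p.τ) < 1)
    (h : thetaStar P B p 0 < 0) {κ : ℝ} (hκ : κ ∈ Icc (0 : ℝ) 1) : thetaStar P B p κ < 0 := by
  have h0 := M.thetaStar_eq hde (left_mem_Icc.2 zero_le_one)
  have h1 := M.thetaStar_eq hde hκ
  rw [zero_mul] at h0
  by_contra! hge
  have hκθ : 0 ≤ κ * thetaStar P B p κ := mul_nonneg hκ.1 hge
  have h2 := mul_le_mul_of_nonneg_left (M.Phi_le_add hκθ) p.disc_pos.le
  rw [← h1, sub_zero, mul_add, ← h0, ← mul_assoc] at h2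
  have h3 : κ * thetaStar P B p κ ≤ thetaStar P B p κ := mul_le_of_le_one_left hge hκ.2
  have hpos : 0 ≤ p.disc * Real.exp (p.h * p.τ) := mul_nonneg p.disc_pos.le (Real.exp_pos _).le
  nlinarith [mul_le_mul_of_nonneg_left h3 hpos]

/-- If the gap `κ'θ' - κθ` were nonnegative, then `θ < 0` makes it smaller than `κ'(θ' - θ)`, which
the Lipschitz bound puts below `d` times the gap, with `d < 1`. -/
lemma mul_thetaStar_strictAnti (M : KernelRegular P B p)
    (hde : p.disc * Real.exp (p.h * p.τ) < 1) (h : thetaStar P B p 0 < 0) {κ κ' : ℝ}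
    (hκ : κ ∈ Icc (0 : ℝ) 1) (hκ' : κ' ∈ Icc (0 : ℝ) 1) (hlt : κ < κ') :
    κ' * thetaStar P B p κ' < κ * thetaStar P B p κ := by
  by_contra! hle
  have h1 := M.thetaStar_eq hde hκ
  have h2 := M.thetaStar_eq hde hκ'
  have hneg := M.thetaStar_neg hde h hκ
  have h3 := mul_le_mul_of_nonneg_left (M.Phi_le_add hle) p.disc_pos.le
  rw [mul_add, ← h1, ← h2, ← mul_assoc] at h3
  have hpos : 0 ≤ p.disc * Real.exp (p.h * p.τ) := mul_nonneg p.disc_pos.le (Real.exp_pos _).le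
  set θ := thetaStar P B p κ
  set θ' := thetaStar P B p κ'
  set d := p.disc * Real.exp (p.h * p.τ)
  have h4 : κ' * (θ' - θ) ≤ κ' * (d * (κ' * θ' - κ * θ)) :=
    mul_le_mul_of_nonneg_left (by linarith) hκ'.1
  have h5 : κ' * (d * (κ' * θ' - κ * θ)) ≤ 1 * (d * (κ' * θ' - κ * θ)) :=
    mul_le_mul_of_nonneg_right hκ'.2 (mul_nonneg hpos (by linarith))
  have h6 : (κ' - κ) * θ < 0 := mul_neg_of_pos_of_neg (by linarith) hneg
  nlinarith

lemma subgradients_mono {θ θ' s s' : ℝ} (hθ : θ < θ') (hs : s ∈ subgradients P B p θ)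
    (hs' : s' ∈ subgradients P B p θ') : s ≤ s' := by
  have h1 := hs θ'
  have h2 := hs' θ
  nlinarith

/-- For `0 < β < 1` a larger `ξ` gives a strictly smaller argument of the subdifferential, hence no
larger a subgradient. For `β = 0` or `β = 1` the argument is constant and differs from `thetaLow`,
so `G` is a constant singleton. -/
lemma not_lt_of_mem_G (M : KernelRegular P B p) (hτ : 0 < p.τ) (hβ : p.β ∈ Icc (0 : ℝ) 1)
    (hδh : p.h < p.δ) (hneg : thetaStar P B p 0 < 0)
    (hlow : p.β < 1 ∨ thetaStar P B p 1 ≠ p.thetaLow) {ξ ξ' : ℝ}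
    (hξ : ξ ∈ Icc (0 : ℝ) (Real.exp (p.h * p.τ))) (hξ' : ξ' ∈ Icc (0 : ℝ) (Real.exp (p.h * p.τ)))
    (hG : ξ ∈ G P B p ξ) (hG' : ξ' ∈ G P B p ξ') : ¬ξ < ξ' := by
  intro hlt
  rw [M.G_eq_subgradients] at hG hG'
  rcases hβ.1.eq_or_lt with h0 | h0
  · have hκ : ∀ ξ, p.kappa ξ = 0 := fun ξ => by simp [Params.kappa, ← h0]
    rw [hκ, zero_mul] at hG hG'
    exact hlt.ne (M.subgradients_subsingleton (Params.thetaLow_neg M.hk).ne' hG hG')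
  rcases hβ.2.eq_or_lt with h1 | h1
  · have hκ : ∀ ξ, p.kappa ξ = 1 := fun ξ => by simp [Params.kappa, h1]
    rw [hκ, one_mul] at hG hG'
    exact hlt.ne (M.subgradients_subsingleton (hlow.resolve_left (by linarith)) hG hG')
  · have := M.mul_thetaStar_strictAnti (Params.disc_mul_exp_lt_one hτ hδh) hneg
      (Params.kappa_mem_Icc hβ hτ hδh hξ) (Params.kappa_mem_Icc hβ hτ hδh hξ')
      (Params.kappa_lt_kappa ⟨h0, h1⟩ hτ hδh hξ' hlt)
    exact absurd (subgradients_mono this hG' hG) (not_le.2 hlt)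

end KernelRegular

end PresentBias

end

open PresentBias in
theorem mainTheorem4 {Ω : Type*} [MeasurableSpace Ω] (P : Measure Ω) [IsProbabilityMeasure P]
    [P.IsComplete] (B : ℝ≥0 → Ω → ℝ) (hB : IsBrownianReal B P) (p : Params)
    (hσ : 0 < p.σ) (hφ : p.φ ≠ 0) (hτ : 0 < p.τ) (hα : p.α ∈ Ioo (0 : ℝ) 1) (hk : 0 ≤ p.k)
    (hγ : 0 < p.γ) (hδ : 0 < p.δ) (hβ : p.β ∈ Icc (0 : ℝ) 1) (hδh : p.h < p.δ) :
    -- `θ*` is well defined on `[0,1]`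
    (∀ κ ∈ Icc (0 : ℝ) 1, ∀ θ : ℝ,
      θ = p.disc * Phi P B p (κ * θ) ↔ θ = thetaStar P B p κ) ∧
    -- `G` is well defined as a set-valued map from `[0, e^{hτ}]` to subsets of `[0, e^{hτ}]`
    (∀ ξ ∈ Icc (0 : ℝ) (Real.exp (p.h * p.τ)),
      p.kappa ξ ∈ Icc (0 : ℝ) 1 ∧ G P B p ξ ⊆ Icc 0 (Real.exp (p.h * p.τ))) ∧
    -- existence of a fixed point, whatever the sign of `θ*(0)`
    (∃ ξ ∈ Icc (0 : ℝ) (Real.exp (p.h * p.τ)), ξ ∈ G P B p ξ) ∧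
    -- uniqueness and explicit value if `θ*(0) = 0`
    (thetaStar P B p 0 = 0 →
      ∃ ξ₀ ∈ Icc (0 : ℝ) (Real.exp (p.h * p.τ)),
        optimalMoments P B p (fun y => p.U (y - p.γ)) = {ξ₀} ∧
        ∀ ξ ∈ Icc (0 : ℝ) (Real.exp (p.h * p.τ)), ξ ∈ G P B p ξ ↔ ξ = ξ₀) ∧
    -- uniqueness if `θ*(0) < 0`
    (thetaStar P B p 0 < 0 → (p.β < 1 ∨ thetaStar P B p 1 ≠ p.thetaLow) →
      ∃! ξ : ℝ, ξ ∈ Icc (0 : ℝ) (Real.exp (p.h * p.τ)) ∧ ξ ∈ G P B p ξ) := by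
  have M : KernelRegular P B p := kernelRegular hB hφ hτ hα hk hγ
  have hde := Params.disc_mul_exp_lt_one hτ hδh
  refine ⟨fun κ hκ θ => M.eq_thetaStar_iff hde hκ θ, fun ξ hξ =>
    ⟨Params.kappa_mem_Icc hβ hτ hδh hξ, ?_⟩, M.exists_mem_G hτ hβ hδh, fun h0 => ?_,
    fun hneg hlow => ?_⟩
  · rw [M.G_eq_subgradients]
    exact M.subgradients_subset_Icc _
  · have hU : (fun y => p.U (y - p.γ)) = fun y => p.F y 0 := by
      funext y
      simp [Params.F]
    obtain ⟨ξ₀, hξ₀⟩ := M.subgradients_nonempty 0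
    have hsing : subgradients P B p 0 = {ξ₀} :=
      (M.subgradients_subsingleton (Params.thetaLow_neg hk).ne').eq_singleton_of_mem hξ₀
    refine ⟨ξ₀, M.subgradients_subset_Icc 0 hξ₀, ?_, fun ξ hξ => ?_⟩
    · rw [hU, M.optimalMoments_eq_subgradients, hsing]
    -- `θ*(0) = 0` means `Φ(0) = 0`, so `0` is the fixed point for every `κ`.
    · have hΦ := M.thetaStar_eq hde (left_mem_Icc.2 zero_le_one)
      rw [h0, mul_zero] at hΦ
      have hθ : thetaStar P B p (p.kappa ξ) = 0 :=
        ((M.eq_thetaStar_iff hde (Params.kappa_mem_Icc hβ hτ hδh hξ) 0).1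
          (by rw [mul_zero]; exact hΦ)).symm
      rw [M.G_eq_subgradients, hθ, mul_zero, hsing, mem_singleton_iff]
  · obtain ⟨ξ, hξ, hG⟩ := M.exists_mem_G hτ hβ hδh
    refine ⟨ξ, ⟨hξ, hG⟩, fun ξ' hξ' => le_antisymm ?_ ?_⟩
    · exact not_lt.1 (M.not_lt_of_mem_G hτ hβ hδh hneg hlow hξ hξ'.1 hG hξ'.2)
    · exact not_lt.1 (M.not_lt_of_mem_G hτ hβ hδh hneg hlow hξ'.1 hξ hξ'.2 hG)
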